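/- Let $m\neq -8,-3,0,5$ be an integer such that $q_m=m^2+3m+9$ is squarefree, and write $m=r+36k$ with $k\in\mathbb{Z}$ and $1\le r\le 36$. Let $\alpha_m$ be a root of $$f_m(x)=x^6-2mx^5-(5m+15)x^4-20x^3+5mx^2+(2m+6)x+1$$ and let $K_m=\mathbb{Q}(\alpha_m)$ (the simplest sextic field). Then $3\nmid r$, and the following six elements, with $x=\alpha_m$, form an integral basis of $K_m$ (a $\mathbb{Z}$-basis of its ring of integers): $1,\ x,\ x^2,\ b_4,\ b_5,\ b_6$, where $(b_4,b_5,b_6)$ depends only on $r$: - $r=1$: $\frac{1+x+x^3}{2},\ \frac{4+x+3x^2+x^4}{6},\ \frac{11+3x+13x^2+6x^3+2x^4+x^5}{18}$ - $r=2,11$: $x^3,\ \frac{1+x^3+x^4}{3},\ \frac{2+7x+6x^2+2x^3+x^5}{9}$ - $r=4$: $\frac{1+x^2+x^3}{2},\ \frac{1+x+3x^2+x^4}{6},\ \frac{8+3x+x^2+3x^3+2x^4+x^5}{18}$ - $r=5$: $\frac{1+x+x^3}{2},\ \frac{1+3x^2+x^3+x^4}{6},\ \frac{8+10x+3x^2+5x^3+x^5}{18}$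 - $r=7,34$: $x^3,\ \frac{1+x+x^4}{3},\ \frac{5+3x+7x^2+2x^4+x^5}{9}$ - $r=8$: $\frac{1+x^2+x^3}{2},\ \frac{4+3x+x^3+x^4}{6},\ \frac{5+13x+8x^3+x^5}{18}$ - $r=10,19$: $x^3,\ \frac{1+x+x^4}{3},\ \frac{2+3x+4x^2+6x^3+2x^4+x^5}{9}$ - $r=13$: $\frac{1+x+x^3}{2},\ \frac{4+x+3x^2+x^4}{6},\ \frac{8+12x+x^2+3x^3+2x^4+x^5}{18}$ - $r=14,23$: $x^3,\ \frac{1+x^3+x^4}{3},\ \frac{8+x+3x^2+5x^3+x^5}{9}$ - $r=16$: $\frac{1+x^2+x^3}{2},\ \frac{1+x+3x^2+x^4}{6},\ \frac{5+3x+16x^2+2x^4+x^5}{18}$ - $r=17$: $\frac{1+x+x^3}{2},\ \frac{1+3x^2+x^3+x^4}{6},\ \frac{5+13x+9x^2+8x^3+x^5}{18}$ - $r=20$: $\frac{1+x^2+x^3}{2},\ \frac{4+3x+x^3+x^4}{6},\ \frac{11+7x+6x^2+2x^3+x^5}{18}$ - $r=22,31$: $x^3,\ \frac{1+x+x^4}{3},\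 \frac{8+3x+x^2+3x^3+2x^4+x^5}{9}$ - $r=25$: $\frac{1+x+x^3}{2},\ \frac{4+x+3x^2+x^4}{6},\ \frac{5+3x+7x^2+2x^4+x^5}{18}$ - $r=26,35$: $x^3,\ \frac{1+x^3+x^4}{3},\ \frac{5+4x+8x^3+x^5}{9}$ - $r=28$: $\frac{1+x^2+x^3}{2},\ \frac{1+x+3x^2+x^4}{6},\ \frac{11+3x+4x^2+6x^3+2x^4+x^5}{18}$ - $r=29$: $\frac{1+x+x^3}{2},\ \frac{1+3x^2+x^3+x^4}{6},\ \frac{11+7x+15x^2+2x^3+x^5}{18}$ - $r=32$: $\frac{1+x^2+x^3}{2},\ \frac{4+3x+x^3+x^4}{6},\ \frac{8+x+3x^2+5x^3+x^5}{18}$ The discriminant of $K_m$ is $D_{K_m}=q_m^5$ if $r\in\{1,4,5,8,13,16,17,20,25,28,29,32\}$, and $D_{K_m}=2^6 q_m^5$ if $r\in\{2,7,10,11,14,19,22,23,26,31,34,35\}$. In particular, the form of the integral basis is periodic in $m$ with period 36. -/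

import Mathlib

open Polynomial NumberField

/-- The number `q_m = m² + 3m + 9`. -/
def simplestSexticQ (m : ℤ) : ℤ := m ^ 2 + 3 * m + 9

/-- The simplest sextic polynomial
`f_m = x⁶ - 2m x⁵ - (5m+15) x⁴ - 20 x³ + 5m x² + (2m+6) x + 1`. -/
noncomputable def simplestSexticPoly (m : ℤ) : ℤ[X] :=
  X ^ 6 - C (2 * m) * X ^ 5 - C (5 * m + 15) * X ^ 4 - C 20 * X ^ 3 + C (5 * m) * X ^ 2
    + C (2 * m + 6) * X + 1

set_option maxHeartbeats 2000000 in
/-- The six elements attached to the residue class `r` modulo `36` and the element `x`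
(the value `0` for the `r` outside the table, `r` divisible by `3`, is never used). -/
def simplestSexticBasis {K : Type*} [Field K] (r : ℕ) (x : K) : Fin 6 → K :=
  match r with
  | 1 => ![1, x, x ^ 2, (1 + x + x ^ 3) / 2, (4 + x + 3 * x ^ 2 + x ^ 4) / 6,
      (11 + 3 * x + 13 * x ^ 2 + 6 * x ^ 3 + 2 * x ^ 4 + x ^ 5) / 18]
  | 2 | 11 => ![1, x, x ^ 2, x ^ 3, (1 + x ^ 3 + x ^ 4) / 3,
      (2 + 7 * x + 6 * x ^ 2 + 2 * x ^ 3 + x ^ 5) / 9]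
  | 4 => ![1, x, x ^ 2, (1 + x ^ 2 + x ^ 3) / 2, (1 + x + 3 * x ^ 2 + x ^ 4) / 6,
      (8 + 3 * x + x ^ 2 + 3 * x ^ 3 + 2 * x ^ 4 + x ^ 5) / 18]
  | 5 => ![1, x, x ^ 2, (1 + x + x ^ 3) / 2, (1 + 3 * x ^ 2 + x ^ 3 + x ^ 4) / 6,
      (8 + 10 * x + 3 * x ^ 2 + 5 * x ^ 3 + x ^ 5) / 18]
  | 7 | 34 => ![1, x, x ^ 2, x ^ 3, (1 + x + x ^ 4) / 3,
      (5 + 3 * x + 7 * x ^ 2 + 2 * x ^ 4 + x ^ 5) / 9]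
  | 8 => ![1, x, x ^ 2, (1 + x ^ 2 + x ^ 3) / 2, (4 + 3 * x + x ^ 3 + x ^ 4) / 6,
      (5 + 13 * x + 8 * x ^ 3 + x ^ 5) / 18]
  | 10 | 19 => ![1, x, x ^ 2, x ^ 3, (1 + x + x ^ 4) / 3,
      (2 + 3 * x + 4 * x ^ 2 + 6 * x ^ 3 + 2 * x ^ 4 + x ^ 5) / 9]
  | 13 => ![1, x, x ^ 2, (1 + x + x ^ 3) / 2, (4 + x + 3 * x ^ 2 + x ^ 4) / 6,
      (8 + 12 * x + x ^ 2 + 3 * x ^ 3 + 2 * x ^ 4 + x ^ 5) / 18]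
  | 14 | 23 => ![1, x, x ^ 2, x ^ 3, (1 + x ^ 3 + x ^ 4) / 3,
      (8 + x + 3 * x ^ 2 + 5 * x ^ 3 + x ^ 5) / 9]
  | 16 => ![1, x, x ^ 2, (1 + x ^ 2 + x ^ 3) / 2, (1 + x + 3 * x ^ 2 + x ^ 4) / 6,
      (5 + 3 * x + 16 * x ^ 2 + 2 * x ^ 4 + x ^ 5) / 18]
  | 17 => ![1, x, x ^ 2, (1 + x + x ^ 3) / 2, (1 + 3 * x ^ 2 + x ^ 3 + x ^ 4) / 6,
      (5 + 13 * x + 9 * x ^ 2 + 8 * x ^ 3 + x ^ 5) / 18]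
  | 20 => ![1, x, x ^ 2, (1 + x ^ 2 + x ^ 3) / 2, (4 + 3 * x + x ^ 3 + x ^ 4) / 6,
      (11 + 7 * x + 6 * x ^ 2 + 2 * x ^ 3 + x ^ 5) / 18]
  | 22 | 31 => ![1, x, x ^ 2, x ^ 3, (1 + x + x ^ 4) / 3,
      (8 + 3 * x + x ^ 2 + 3 * x ^ 3 + 2 * x ^ 4 + x ^ 5) / 9]
  | 25 => ![1, x, x ^ 2, (1 + x + x ^ 3) / 2, (4 + x + 3 * x ^ 2 + x ^ 4) / 6,
      (5 + 3 * x + 7 * x ^ 2 + 2 * x ^ 4 + x ^ 5) / 18]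
  | 26 | 35 => ![1, x, x ^ 2, x ^ 3, (1 + x ^ 3 + x ^ 4) / 3,
      (5 + 4 * x + 8 * x ^ 3 + x ^ 5) / 9]
  | 28 => ![1, x, x ^ 2, (1 + x ^ 2 + x ^ 3) / 2, (1 + x + 3 * x ^ 2 + x ^ 4) / 6,
      (11 + 3 * x + 4 * x ^ 2 + 6 * x ^ 3 + 2 * x ^ 4 + x ^ 5) / 18]
  | 29 => ![1, x, x ^ 2, (1 + x + x ^ 3) / 2, (1 + 3 * x ^ 2 + x ^ 3 + x ^ 4) / 6,
      (11 + 7 * x + 15 * x ^ 2 + 2 * x ^ 3 + x ^ 5) / 18]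
  | 32 => ![1, x, x ^ 2, (1 + x ^ 2 + x ^ 3) / 2, (4 + 3 * x + x ^ 3 + x ^ 4) / 6,
      (8 + x + 3 * x ^ 2 + 5 * x ^ 3 + x ^ 5) / 18]
  | _ => 0

/-- The discriminant attached to the residue class `r` modulo `36`: `q_m⁵` for the `r` listed,
`2⁶ q_m⁵` for the other `r` not divisible by `3`. -/
def simplestSexticDiscr (r : ℕ) (m : ℤ) : ℤ :=
  if r ∈ ({1, 4, 5, 8, 13, 16, 17, 20, 25, 28, 29, 32} : Finset ℕ) then
    simplestSexticQ m ^ 5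
  else
    2 ^ 6 * simplestSexticQ m ^ 5

/-! A full-rank lattice of integral elements is the whole ring of integers once it is saturated at
every prime dividing its discriminant (`exists_integralBasis_of_isSaturatedAt`). The power lattice
`ℤ[α]` has discriminant `6^6 * q^5`, so only 2, 3 and the primes dividing `q` matter, and `q` is
prime to 6.

At `p ∣ q` the element `3α - m` is a root of an Eisenstein polynomial, so `ℤ[3α - m]` is saturated
there. It has index prime to `p` in each candidate lattice, which is therefore saturated as well.
The same Eisenstein polynomial gives irreducibility and degree 6.

At 3, the integral element `z = 3/(α - 1)` produces a quartic in `α` over 3 and a quintic over 9.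
These give index 27 and remove the factor `3^6` entirely from the discriminant.

At 2, `f` is congruent to the square of an irreducible cubic `g`. If `m` is 0 or 1 mod 4, `g(α)/2`
is integral; its multiples give a further index 8, and the discriminant becomes `q^5`. If `m` is 2
or 3 mod 4, `g(α)/2` is not integral and Dedekind's criterion shows that `ℤ[α]` is already saturated
at 2.

The 3-part depends on `m` mod 9 and the 2-part on `m` mod 4, hence the period 36. -/

/-! ### Saturated lattices and rings of integers -/

open Matrix in
theorem discr_smul_mem_span {K ι : Type*} [Field K] [NumberField K] [Fintype ι] [DecidableEq ι]
    (b : Module.Basis ι ℚ K) (hb : ∀ i, IsIntegral ℤ (b i)) {z : K} (hz : IsIntegral ℤ z) :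
    Algebra.discr ℚ b • z ∈ Submodule.span ℤ (Set.range b) := by
  have hinv : IsUnit (Algebra.traceMatrix ℚ b).det := by
    simpa [← Algebra.discr_def] using Algebra.discr_isUnit_of_basis _ b
  have H : (Algebra.traceMatrix ℚ b).det • (Algebra.traceMatrix ℚ b) *ᵥ (b.equivFun z) =
      (Algebra.traceMatrix ℚ b).det • fun i => Algebra.trace ℚ K (z * b i) := by
    congr; exact Algebra.traceMatrix_of_basis_mulVec _ _
  -- Cramer's rule for the trace form: the discriminant times a coordinate of `z` is a determinant
  -- whose entries are traces of integral elements, hence integers.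
  have cramer := mulVec_cramer (Algebra.traceMatrix ℚ b) fun i => Algebra.trace ℚ K (z * b i)
  suffices ∀ i, ((Algebra.traceMatrix ℚ b).det • b.equivFun z) i ∈ (⊥ : Subalgebra ℤ ℚ) by
    rw [← b.sum_repr z, Finset.smul_sum]
    refine Submodule.sum_mem _ fun i _ => ?_
    replace this := this i
    rw [← Algebra.discr_def, Pi.smul_apply, Algebra.mem_bot] at this
    obtain ⟨r, hr⟩ := this
    rw [Module.Basis.equivFun_apply] at hr
    rw [← smul_assoc, ← hr, algebraMap_smul]
    exact Submodule.smul_mem _ _ (Submodule.subset_span ⟨i, rfl⟩)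
  intro i
  rw [← H, ← mulVec_smul] at cramer
  replace cramer := congr_arg (mulVec (Algebra.traceMatrix ℚ b)⁻¹) cramer
  rw [mulVec_mulVec, nonsing_inv_mul _ hinv, mulVec_mulVec, nonsing_inv_mul _ hinv, one_mulVec,
    one_mulVec] at cramer
  rw [← congr_fun cramer i, cramer_apply, det_apply]
  refine Subalgebra.sum_mem _ fun σ _ =>
    Subalgebra.zsmul_mem _ (Subalgebra.prod_mem _ fun j _ => ?_) _
  by_cases hji : j = i
  · simp only [updateCol_apply, hji]
    exact Algebra.mem_bot.2 (IsIntegrallyClosed.isIntegral_iff.1 <|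
      Algebra.isIntegral_trace (hz.mul <| hb _))
  · simp only [updateCol_apply, hji]
    exact Algebra.mem_bot.2
      (IsIntegrallyClosed.isIntegral_iff.1 <| Algebra.isIntegral_trace <| (hb _).mul (hb _))

/-- A subgroup of a field is saturated at `p` if it contains every integral element whose
`p`-multiple it contains. -/
def IsSaturatedAt {K : Type*} [Field K] (p : ℕ) (M : Submodule ℤ K) : Prop :=
  ∀ z : K, IsIntegral ℤ z → (p : ℤ) • z ∈ M → z ∈ M

/-- Saturation passes to an overlattice killed into `S` by some `N` prime to `p`: both `N • z` and
`p • z` lie in `M`, so a Bézout relation puts `z` there. -/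
theorem IsSaturatedAt.of_le {K : Type*} [Field K] {p : ℕ} {S M : Submodule ℤ K}
    (hS : IsSaturatedAt p S) (hSM : S ≤ M) {N : ℤ} (hN : IsCoprime N p)
    (hMS : ∀ z ∈ M, N • z ∈ S) : IsSaturatedAt p M := by
  intro z hz hpz
  have h1 : N • z ∈ M := hSM <| hS _ (hz.smul _) <| by
    rw [smul_comm]; exact hMS _ hpz
  obtain ⟨a, b, hab⟩ := hN
  have : z = a • N • z + b • (p : ℤ) • z := by
    rw [smul_smul, smul_smul, ← add_smul, hab, one_smul]
  rw [this]
  exact M.add_mem (M.smul_mem _ h1) (M.smul_mem _ hpz)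

theorem mem_of_smul_mem_of_isSaturatedAt {K : Type*} [Field K] {M : Submodule ℤ K} (D : ℕ)
    (hD : D ≠ 0) (hM : ∀ p : ℕ, p.Prime → p ∣ D → IsSaturatedAt p M) {z : K}
    (hz : IsIntegral ℤ z) (h : (D : ℤ) • z ∈ M) : z ∈ M := by
  induction D using Nat.recOnMul generalizing z with
  | zero => exact absurd rfl hD
  | one => simpa using h
  | prime p hp => exact hM p hp dvd_rfl z hz h
  | mul a b ha hb =>
    have ha0 : a ≠ 0 := by rintro rfl; simp at hD
    have hb0 : b ≠ 0 := by rintro rfl; simp at hD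
    refine hb hb0 (fun p hp hpb => hM p hp (hpb.mul_left _)) hz ?_
    refine ha ha0 (fun p hp hpa => hM p hp (hpa.mul_right _)) (hz.smul _) ?_
    rw [smul_smul]
    exact_mod_cast h

theorem exists_integralBasis_of_isSaturatedAt {K ι : Type*} [Field K] [NumberField K] [Fintype ι]
    [DecidableEq ι] (b : Module.Basis ι ℚ K) (hb : ∀ i, IsIntegral ℤ (b i)) (D : ℤ)
    (hD : Algebra.discr ℚ b = D)
    (hM : ∀ p : ℕ, p.Prime → (p : ℤ) ∣ D → IsSaturatedAt p (Submodule.span ℤ (Set.range b))) :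
    (∃ B : Module.Basis ι ℤ (𝓞 K), ∀ i, (B i : K) = b i) ∧ NumberField.discr K = D := by
  have hD0 : D ≠ 0 := by
    have := Algebra.discr_not_zero_of_basis ℚ b
    rw [hD] at this
    exact_mod_cast this
  have key : ∀ z : K, IsIntegral ℤ z → z ∈ Submodule.span ℤ (Set.range b) := by
    intro z hz
    refine mem_of_smul_mem_of_isSaturatedAt D.natAbs (by simpa using hD0)
      (fun p hp hpD => hM p hp (Int.natCast_dvd.2 hpD)) hz ?_
    have h := discr_smul_mem_span b hb hz
    rw [hD, Int.cast_smul_eq_zsmul] at h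
    rcases Int.natAbs_eq D with h' | h'
    · rwa [← h']
    · have := Submodule.neg_mem _ h
      rwa [← neg_smul, show -D = (D.natAbs : ℤ) by omega] at this
  let v : ι → 𝓞 K := fun i => ⟨b i, hb i⟩
  let φ : 𝓞 K →ₗ[ℤ] K := (Algebra.linearMap (𝓞 K) K).restrictScalars ℤ
  have hφ : Function.Injective φ := RingOfIntegers.coe_injective
  have hφv : φ ∘ v = b := rfl
  have hli : LinearIndependent ℤ v := by
    apply LinearIndependent.of_comp φ
    rw [hφv]
    exact b.linearIndependent.restrict_scalars' ℤ
  have hsp : ⊤ ≤ Submodule.span ℤ (Set.range v) := by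
    intro z _
    have h := key z z.isIntegral_coe
    rw [← hφv, Set.range_comp, ← Submodule.map_span] at h
    obtain ⟨w, hw, hwz⟩ := h
    rwa [hφ (a₁ := w) (a₂ := z) hwz] at hw
  let B := Module.Basis.mk hli hsp
  have hB : ∀ i, (B i : K) = b i := fun i => by rw [Module.Basis.mk_apply]; rfl
  refine ⟨⟨B, hB⟩, ?_⟩
  -- The integral and rational bases have the same elements, so their discriminants agree after
  -- localization.
  have h1 : (algebraMap ℤ ℚ) (Algebra.discr ℤ B) = Algebra.discr ℚ b := by
    rw [← Algebra.discr_localizationLocalization ℤ (nonZeroDivisors ℤ) K B]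
    congr 1
    ext i
    rw [Module.Basis.localizationLocalization_apply]
    exact hB i
  rw [discr_eq_discr, hD] at h1
  exact (algebraMap ℤ ℚ).injective_int h1

/-! ### Norms of linear and quadratic expressions in a generator -/

/-- The determinant computing the norm of `t - gen` is the characteristic polynomial. -/
theorem norm_algebraMap_sub_gen {K L : Type*} [Field K] [Field L] [Algebra K L]
    (pb : PowerBasis K L) (t : K) :
    Algebra.norm K (algebraMap K L t - pb.gen) = (minpoly K pb.gen).eval t := by
  classical
  rw [← charpoly_leftMulMatrix, Matrix.eval_charpoly, Algebra.norm_eq_matrix_det pb.basis, map_sub,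
    AlgHom.commutes]
  rfl

/-- Over `E` the quadratic splits as `(A - u)(A - v)`, where `A` is the matrix of multiplication by
the generator, and `det (w - A)` is the characteristic polynomial at `w`. Thus `u` and `v` need not
lie in `K`. -/
theorem norm_quadratic_gen {K L E : Type*} [Field K] [Field L] [Algebra K L] [Field E] [Algebra K E]
    (pb : PowerBasis K L) {s t : K} {u v : E} (hs : algebraMap K E s = u + v)
    (ht : algebraMap K E t = u * v) :
    algebraMap K E (Algebra.norm K (pb.gen ^ 2 - algebraMap K L s * pb.gen + algebraMap K L t)) =
      aeval u (minpoly K pb.gen) * aeval v (minpoly K pb.gen) := by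
  classical
  have h : ∀ w : E, aeval w (minpoly K pb.gen) = (Matrix.scalar _ w -
      (Algebra.leftMulMatrix pb.basis pb.gen).map (algebraMap K E)).det := by
    intro w
    rw [← charpoly_leftMulMatrix, ← Matrix.eval_charpoly, Matrix.charpoly_map, eval_map_algebraMap]
  rw [h, h, ← Matrix.det_mul, Algebra.norm_eq_matrix_det pb.basis, RingHom.map_det]
  congr 1
  set A := Algebra.leftMulMatrix pb.basis pb.gen
  have e1 : (algebraMap K E).mapMatrix A = A.map (algebraMap K E) := rfl
  have e2 : ∀ r : K, (algebraMap K E).mapMatrix (algebraMap K (Matrix _ _ K) r) =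
      Matrix.scalar (Fin pb.dim) (algebraMap K E r) := by
    intro r
    ext i j
    simp [Matrix.algebraMap_matrix_apply, Matrix.diagonal_apply, apply_ite (algebraMap K E)]
  rw [map_add, map_sub, map_mul, map_pow, AlgHom.commutes, AlgHom.commutes, map_add, map_sub,
    map_mul, map_pow, e2, e2, e1, hs, ht, map_add, map_mul]
  have hc : Commute (Matrix.scalar (Fin pb.dim) v) (A.map (algebraMap K E)) :=
    Matrix.scalar_commute _ (fun _ => Commute.all _ _) _
  rw [sub_mul, mul_sub, mul_sub, ← hc.eq, add_mul]
  noncomm_ring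

/-! ### The sextic and its trace-free form -/

theorem aeval_simplestSexticPoly {A : Type*} [CommRing A] (m : ℤ) (x : A) :
    aeval x (simplestSexticPoly m) = x ^ 6 - 2 * m * x ^ 5 - (5 * m + 15) * x ^ 4 - 20 * x ^ 3
      + 5 * m * x ^ 2 + (2 * m + 6) * x + 1 := by
  simp only [simplestSexticPoly, map_add, map_sub, map_mul, map_pow, map_one, aeval_C, aeval_X]
  simp only [algebraMap_int_eq, eq_intCast]
  push_cast
  ring

theorem natDegree_simplestSexticPoly (m : ℤ) : (simplestSexticPoly m).natDegree = 6 := by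
  unfold simplestSexticPoly; compute_degree!

theorem monic_simplestSexticPoly (m : ℤ) : (simplestSexticPoly m).Monic := by
  rw [Monic, leadingCoeff, natDegree_simplestSexticPoly, simplestSexticPoly]
  compute_degree!

/-- The polynomial satisfied by `3 α - m` when `α` is a root of `simplestSexticPoly m`. -/
noncomputable def depressedSexticPoly (m : ℤ) : ℤ[X] :=
  X ^ 6 - C (simplestSexticQ m * 15) * X ^ 4 - C (simplestSexticQ m * (20 * (2 * m + 3))) * X ^ 3
    - C (simplestSexticQ m * (45 * (m * (m + 3)))) * X ^ 2
    + C (simplestSexticQ m * (-24 * m ^ 3 - 108 * m ^ 2 + 162)) * X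
    + C (simplestSexticQ m * (-5 * m ^ 4 - 30 * m ^ 3 + 135 * m + 81))

/-- The roots of `f` sum to `2m`, so `3α - m` has trace zero, and `729 = 3^6` makes the result
monic. Every lower coefficient is then a multiple of `q`. -/
theorem aeval_depressedSexticPoly {A : Type*} [CommRing A] (m : ℤ) (x : A) :
    aeval (3 * x - m) (depressedSexticPoly m) = 729 * aeval x (simplestSexticPoly m) := by
  rw [aeval_simplestSexticPoly]
  simp only [depressedSexticPoly, simplestSexticQ, map_add, map_sub, map_mul, map_pow, aeval_C,
    aeval_X]
  simp only [algebraMap_int_eq, eq_intCast]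
  push_cast
  ring

theorem natDegree_depressedSexticPoly (m : ℤ) : (depressedSexticPoly m).natDegree = 6 := by
  unfold depressedSexticPoly; compute_degree!

theorem monic_depressedSexticPoly (m : ℤ) : (depressedSexticPoly m).Monic := by
  rw [Monic, leadingCoeff, natDegree_depressedSexticPoly, depressedSexticPoly]
  compute_degree!

/-! ### Arithmetic of `q` and the Eisenstein property -/

section Arithmetic

variable {m : ℤ}

theorem not_three_dvd_of_squarefree (hq : Squarefree (simplestSexticQ m)) : ¬ (3 : ℤ) ∣ m := by
  rintro ⟨a, rfl⟩
  have := hq 3 ⟨a ^ 2 + a + 1, by unfold simplestSexticQ; ring⟩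
  rw [Int.isUnit_iff] at this
  omega

theorem simplestSexticQ_emod_three (h : ¬ (3 : ℤ) ∣ m) : simplestSexticQ m % 3 = 1 := by
  have : m % 3 = 1 ∨ m % 3 = 2 := by omega
  unfold simplestSexticQ
  rcases this with h | h <;> simp [Int.add_emod, Int.mul_emod, pow_two, h]

theorem simplestSexticQ_emod_two (m : ℤ) : simplestSexticQ m % 2 = 1 := by
  unfold simplestSexticQ
  rcases Int.emod_two_eq_zero_or_one m with h | h <;>
    simp [Int.add_emod, Int.mul_emod, pow_two, h]

theorem simplestSexticQ_pos (m : ℤ) : 1 < simplestSexticQ m := by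
  unfold simplestSexticQ; nlinarith [sq_nonneg (2 * m + 3)]

theorem prime_ne_of_dvd (h : ¬ (3 : ℤ) ∣ m) {p : ℕ} (hpq : (p : ℤ) ∣ simplestSexticQ m) :
    p ≠ 2 ∧ p ≠ 3 := by
  have h2 := simplestSexticQ_emod_two m
  have h3 := simplestSexticQ_emod_three h
  constructor <;> rintro rfl <;> push_cast at hpq <;> omega

theorem isEisensteinAt_depressedSexticPoly (hq : Squarefree (simplestSexticQ m)) {p : ℕ}
    (hp : p.Prime) (hpq : (p : ℤ) ∣ simplestSexticQ m) :
    (depressedSexticPoly m).IsEisensteinAt (Submodule.span ℤ {(p : ℤ)}) := by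
  have hp' : Prime (p : ℤ) := Nat.prime_iff_prime_int.1 hp
  have hc0 : (depressedSexticPoly m).coeff 0 =
      simplestSexticQ m * (-5 * m ^ 4 - 30 * m ^ 3 + 135 * m + 81) := by
    simp [depressedSexticPoly, coeff_zero_eq_eval_zero]
  refine ⟨?_, ?_, ?_⟩
  · rw [monic_depressedSexticPoly, Ideal.submodule_span_eq, Ideal.mem_span_singleton]
    exact hp'.not_dvd_one
  · intro n hn
    rw [natDegree_depressedSexticPoly] at hn
    rw [Ideal.submodule_span_eq, Ideal.mem_span_singleton]
    refine hpq.trans ?_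
    interval_cases n
    · rw [hc0]; exact dvd_mul_right _ _
    all_goals
      simp only [depressedSexticPoly, coeff_add, coeff_sub, coeff_C_mul, coeff_X_pow, coeff_X,
        coeff_C]
      norm_num
  · rw [hc0, Ideal.submodule_span_eq, Ideal.span_singleton_pow, Ideal.mem_span_singleton]
    rintro h
    obtain ⟨c, hc⟩ := hpq
    rw [hc, pow_two, mul_assoc] at h
    rcases hp'.dvd_or_dvd ((mul_dvd_mul_iff_left hp'.ne_zero).1 h) with h1 | h1
    · have := hq p (hc ▸ mul_dvd_mul_left _ h1)
      exact hp'.not_isUnit this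
    -- Modulo `q` the cofactor of the constant term is `-3^6`, so a common prime factor with `q`
    -- could only be 3.
    · have h2 : (p : ℤ) ∣ 3 ^ 6 := by
        have : (3 : ℤ) ^ 6 = p * (c * (-5 * m ^ 2 - 15 * m + 90))
            - (-5 * m ^ 4 - 30 * m ^ 3 + 135 * m + 81) := by
          rw [← mul_assoc, ← hc]; unfold simplestSexticQ; ring
        rw [this]
        exact dvd_sub (dvd_mul_right _ _) h1
      have h3 : (p : ℤ) ∣ 3 := hp'.dvd_of_dvd_pow h2
      have h4 : p ∣ 3 := by exact_mod_cast h3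
      rw [Nat.prime_dvd_prime_iff_eq hp Nat.prime_three] at h4
      exact (prime_ne_of_dvd (not_three_dvd_of_squarefree hq) ⟨c, hc⟩).2 h4

theorem irreducible_depressedSexticPoly (hq : Squarefree (simplestSexticQ m)) :
    Irreducible (depressedSexticPoly m) := by
  have h1 := simplestSexticQ_pos m
  obtain ⟨p, hp, hpq⟩ := Nat.exists_prime_and_dvd (n := (simplestSexticQ m).natAbs) (by omega)
  refine (isEisensteinAt_depressedSexticPoly hq hp (Int.natCast_dvd.2 hpq)).irreducible ?_
    (monic_depressedSexticPoly m).isPrimitive (by rw [natDegree_depressedSexticPoly]; norm_num)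
  rw [Ideal.submodule_span_eq, Ideal.span_singleton_prime (by exact_mod_cast hp.ne_zero)]
  exact Nat.prime_iff_prime_int.1 hp

end Arithmetic

/-! ### Degree and minimal polynomial -/

section Field

variable {K : Type*} [Field K] [NumberField K] {m : ℤ} {α : K}

omit [NumberField K] in
theorem isIntegral_of_root (hα : aeval α (simplestSexticPoly m) = 0) : IsIntegral ℤ α :=
  ⟨_, monic_simplestSexticPoly m, hα⟩

theorem minpoly_depressed (hq : Squarefree (simplestSexticQ m))
    (hα : aeval α (simplestSexticPoly m) = 0) :
    minpoly ℤ (3 * α - m) = depressedSexticPoly m := by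
  have h0 : aeval (3 * α - m) (depressedSexticPoly m) = 0 := by
    rw [aeval_depressedSexticPoly, hα, mul_zero]
  have hint : IsIntegral ℤ (3 * α - m) := ⟨_, monic_depressedSexticPoly m, h0⟩
  obtain ⟨c, hc⟩ := minpoly.isIntegrallyClosed_dvd hint h0
  have hu := (irreducible_depressedSexticPoly hq).isUnit_or_isUnit hc
  exact eq_of_monic_of_associated (minpoly.monic hint) (monic_depressedSexticPoly m)
    ⟨(hu.resolve_left (minpoly.not_isUnit ℤ _)).unit, hc.symm⟩

theorem adjoin_depressed (hK : IntermediateField.adjoin ℚ {α} = ⊤) :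
    IntermediateField.adjoin ℚ {3 * α - m} = ⊤ := by
  rw [eq_top_iff, ← hK, IntermediateField.adjoin_simple_le_iff]
  have h : 3 * α - m ∈ IntermediateField.adjoin ℚ {3 * α - (m : K)} :=
    IntermediateField.mem_adjoin_simple_self _ _
  have : α = (3 * α - m + m) / 3 := by ring
  have h' := div_mem (add_mem h (intCast_mem _ m)) (ofNat_mem _ 3)
  rwa [← this] at h'

theorem finrank_eq_six (hq : Squarefree (simplestSexticQ m))
    (hα : aeval α (simplestSexticPoly m) = 0) (hK : IntermediateField.adjoin ℚ {α} = ⊤) :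
    Module.finrank ℚ K = 6 := by
  have h0 : aeval (3 * α - m) (depressedSexticPoly m) = 0 := by
    rw [aeval_depressedSexticPoly, hα, mul_zero]
  have hint : IsIntegral ℤ (3 * α - m) := ⟨_, monic_depressedSexticPoly m, h0⟩
  rw [← IntermediateField.finrank_top', ← adjoin_depressed (m := m) hK,
    IntermediateField.adjoin.finrank hint.tower_top,
    minpoly.isIntegrallyClosed_eq_field_fractions' ℚ hint, minpoly_depressed hq hα,
    (monic_depressedSexticPoly m).natDegree_map, natDegree_depressedSexticPoly]

theorem minpoly_root (hq : Squarefree (simplestSexticQ m))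
    (hα : aeval α (simplestSexticPoly m) = 0) (hK : IntermediateField.adjoin ℚ {α} = ⊤) :
    minpoly ℚ α = (simplestSexticPoly m).map (algebraMap ℤ ℚ) := by
  have hint := isIntegral_of_root hα
  have hm := (monic_simplestSexticPoly m).map (algebraMap ℤ ℚ)
  symm
  refine eq_of_monic_of_dvd_of_natDegree_le (minpoly.monic hint.tower_top) hm
    (minpoly.dvd _ _ (by rwa [aeval_map_algebraMap])) ?_
  rw [(monic_simplestSexticPoly m).natDegree_map, natDegree_simplestSexticPoly,
    ← finrank_eq_six hq hα hK, ← IntermediateField.finrank_top', ← hK,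
    IntermediateField.adjoin.finrank hint.tower_top]

/-- The power basis of a number field given by an integral primitive element. -/
noncomputable def powerBasisOfAdjoin (hα : IsIntegral ℤ α)
    (hK : IntermediateField.adjoin ℚ {α} = ⊤) : PowerBasis ℚ K :=
  PowerBasis.ofAdjoinEqTop (hα.tower_top (A := ℚ)) <| by
    rw [← IntermediateField.adjoin_simple_toSubalgebra_of_isAlgebraic
      (hα.tower_top (A := ℚ)).isAlgebraic, hK, IntermediateField.top_toSubalgebra]

theorem powerBasisOfAdjoin_gen (hα : IsIntegral ℤ α)
    (hK : IntermediateField.adjoin ℚ {α} = ⊤) : (powerBasisOfAdjoin hα hK).gen = α := rfl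

end Field

/-! ### The discriminant of the power basis -/

section Discriminant

theorem aeval_simplestSexticPoly_of_root_cyclotomic {A : Type*} [CommRing A] (m : ℤ) {w : A}
    (hw : w ^ 2 + w + 1 = 0) :
    aeval w (simplestSexticPoly m) = -(18 + 3 * m) - (6 * m + 9) * w := by
  have h3 : w ^ 3 = 1 := by linear_combination (w - 1) * hw
  rw [aeval_simplestSexticPoly]
  linear_combination (w ^ 3 + 1 - 2 * m * w ^ 2 - (5 * m + 15) * w - 20) * h3 + 3 * m * hw

theorem Complex.exists_sq_add_self_add_one_eq_zero : ∃ w : ℂ, w ^ 2 + w + 1 = 0 := by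
  refine ⟨(-1 + (Real.sqrt 3 : ℂ) * Complex.I) / 2, ?_⟩
  have hs : (Real.sqrt 3 : ℂ) ^ 2 = 3 := by
    rw [← Complex.ofReal_pow, Real.sq_sqrt (by norm_num)]; norm_num
  linear_combination (Complex.I ^ 2 / 4) * hs + (3 / 4) * Complex.I_sq

variable {K : Type*} [Field K] [NumberField K] {m : ℤ} {α : K}

/-- The norm is `f(ω) f(ω²)` for a primitive cube root of unity `ω`, where `f` is linear modulo `ω²
+ ω + 1`. -/
theorem norm_cyclotomic_root (hq : Squarefree (simplestSexticQ m))
    (hα : aeval α (simplestSexticPoly m) = 0) (hK : IntermediateField.adjoin ℚ {α} = ⊤) :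
    Algebra.norm ℚ (α ^ 2 + α + 1) = 27 * simplestSexticQ m := by
  obtain ⟨w, hw⟩ := Complex.exists_sq_add_self_add_one_eq_zero
  have hw' : (-1 - w) ^ 2 + (-1 - w) + 1 = 0 := by linear_combination hw
  have h := norm_quadratic_gen (E := ℂ) (powerBasisOfAdjoin (isIntegral_of_root hα) hK)
    (s := -1) (t := 1) (u := w) (v := -1 - w) (by simp)
    (by rw [map_one]; linear_combination hw)
  rw [powerBasisOfAdjoin_gen, minpoly_root hq hα hK, aeval_map_algebraMap, aeval_map_algebraMap,
    aeval_simplestSexticPoly_of_root_cyclotomic m hw,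
    aeval_simplestSexticPoly_of_root_cyclotomic m hw'] at h
  have e : α ^ 2 - algebraMap ℚ K (-1) * α + algebraMap ℚ K 1 = α ^ 2 + α + 1 := by
    rw [map_neg, map_one]; ring
  rw [e] at h
  apply (algebraMap ℚ ℂ).injective
  rw [h, simplestSexticQ]
  push_cast
  simp only [map_ofNat, map_intCast]
  linear_combination -(6 * (m : ℂ) + 9) ^ 2 * hw

theorem norm_sub_root (hq : Squarefree (simplestSexticQ m))
    (hα : aeval α (simplestSexticPoly m) = 0) (hK : IntermediateField.adjoin ℚ {α} = ⊤) (t : ℚ) :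
    Algebra.norm ℚ (algebraMap ℚ K t - α) = t ^ 6 - 2 * m * t ^ 5 - (5 * m + 15) * t ^ 4
      - 20 * t ^ 3 + 5 * m * t ^ 2 + (2 * m + 6) * t + 1 := by
  have h := norm_algebraMap_sub_gen (powerBasisOfAdjoin (isIntegral_of_root hα) hK) t
  rw [powerBasisOfAdjoin_gen, minpoly_root hq hα hK, eval_map_algebraMap,
    aeval_simplestSexticPoly] at h
  exact h

omit [NumberField K] in
-- Write `f = A - m B` with `B = x(x - 1)(x + 1)(x + 2)(2x + 1)`. Then `f' B - B' f` is the
-- Wronskian `A' B - A B'`, which is free of `m` and equals `2(x² + x + 1)^5`. The coefficient in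
-- the final combination is `B'(α)`.
theorem derivative_mul_eq (hα : aeval α (simplestSexticPoly m) = 0) :
    aeval α (derivative (simplestSexticPoly m)) *
      ((α + 2) * (2 * α + 1) * (α + 1) * α * (α - 1)) = 2 * (α ^ 2 + α + 1) ^ 5 := by
  rw [aeval_simplestSexticPoly] at hα
  have h : aeval α (derivative (simplestSexticPoly m)) = 6 * α ^ 5 - 10 * m * α ^ 4
      - 4 * (5 * m + 15) * α ^ 3 - 60 * α ^ 2 + 10 * m * α + (2 * m + 6) := by
    simp only [simplestSexticPoly, derivative_add, derivative_sub, derivative_C_mul,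
      derivative_X_pow, derivative_X, derivative_one]
    simp only [map_add, map_sub, map_mul, map_pow, map_one, map_zero, aeval_C, aeval_X]
    simp only [algebraMap_int_eq, eq_intCast, map_natCast]
    push_cast
    ring
  rw [h]
  linear_combination (-2 - 10 * α + 20 * α ^ 3 + 10 * α ^ 4) * hα

theorem norm_derivative (hq : Squarefree (simplestSexticQ m))
    (hα : aeval α (simplestSexticPoly m) = 0) (hK : IntermediateField.adjoin ℚ {α} = ⊤) :
    Algebra.norm ℚ (aeval α (derivative (simplestSexticPoly m))) =
      -(6 ^ 6 * (simplestSexticQ m : ℚ) ^ 5) := by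
  have h := congrArg (Algebra.norm ℚ) (derivative_mul_eq hα)
  have hn := norm_sub_root hq hα hK
  -- The factors are rewritten as `t - α` over the roots `t` of `B`, where the norm `f(t)` does not
  -- depend on `m`.
  have e : (α + 2) * (2 * α + 1) * (α + 1) * α * (α - 1) = algebraMap ℚ K (-2) *
      ((algebraMap ℚ K (-2) - α) * (algebraMap ℚ K (-1 / 2) - α) * (algebraMap ℚ K (-1) - α) *
      (algebraMap ℚ K 0 - α) * (algebraMap ℚ K 1 - α)) := by
    simp only [map_neg, map_div₀, map_one, map_ofNat, map_zero]
    field_simp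
    ring
  have e2 : (2 : K) = algebraMap ℚ K 2 := (map_ofNat _ 2).symm
  rw [e, map_mul, map_mul, map_mul, map_mul, map_mul, map_mul, map_mul, map_pow,
    norm_cyclotomic_root hq hα hK, e2, hn, hn, hn, hn, hn, Algebra.norm_algebraMap,
    Algebra.norm_algebraMap, finrank_eq_six hq hα hK] at h
  ring_nf at h ⊢
  linarith

theorem discr_pow_root (hq : Squarefree (simplestSexticQ m))
    (hα : aeval α (simplestSexticPoly m) = 0) (hK : IntermediateField.adjoin ℚ {α} = ⊤) :
    Algebra.discr ℚ (fun i : Fin 6 => α ^ (i : ℕ)) = 6 ^ 6 * (simplestSexticQ m : ℚ) ^ 5 := by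
  set pb := powerBasisOfAdjoin (isIntegral_of_root hα) hK with hpb
  have hgen : pb.gen = α := rfl
  have hfin := finrank_eq_six hq hα hK
  have hdim : pb.dim = 6 := by rw [← pb.finrank, hfin]
  have h := Algebra.discr_powerBasis_eq_norm ℚ pb
  rw [hfin, hgen, minpoly_root hq hα hK, derivative_map, aeval_map_algebraMap,
    norm_derivative hq hα hK, ← Algebra.discr_reindex ℚ _ (finCongr hdim)] at h
  have e : (fun i : Fin 6 => α ^ (i : ℕ)) = pb.basis ∘ (finCongr hdim).symm := by
    ext i
    simp [hgen]
  rw [e, h]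
  norm_num

end Discriminant

/-! ### Dedekind's criterion for a square modulo `p` -/

section Saturation

variable {K : Type*} [Field K] [NumberField K] {α : K}

omit [NumberField K] in
theorem mem_adjoin_iff_exists_aeval {z : K} :
    z ∈ Subalgebra.toSubmodule (Algebra.adjoin ℤ {α}) ↔ ∃ P : ℤ[X], aeval α P = z := by
  rw [Subalgebra.mem_toSubmodule, Algebra.adjoin_singleton_eq_range_aeval]
  rfl

theorem exists_eq_add_of_map_eq {p : ℕ} {P Q : ℤ[X]}
    (h : P.map (Int.castRingHom (ZMod p)) = Q.map (Int.castRingHom (ZMod p))) :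
    ∃ S : ℤ[X], P = Q + C (p : ℤ) * S := by
  have : C (p : ℤ) ∣ P - Q := by
    rw [C_dvd_iff_dvd_coeff]
    intro i
    have hi := congrArg (fun R => coeff R i) h
    simp only [coeff_map, eq_intCast] at hi
    rw [coeff_sub]
    exact ((ZMod.intCast_eq_intCast_iff_dvd_sub _ _ _).1 hi.symm)
  obtain ⟨S, hS⟩ := this
  exact ⟨S, by rw [← hS]; ring⟩

omit [NumberField K] in
theorem isIntegral_aeval (hα : IsIntegral ℤ α) (P : ℤ[X]) : IsIntegral ℤ (aeval α P) :=
  .of_mem_of_fg _ hα.fg_adjoin_singleton _ (aeval_mem_adjoin_singleton ℤ α)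

/-- The case of Dedekind's criterion where the polynomial is a square of an irreducible modulo
`p`. -/
theorem isSaturatedAt_adjoin_of_map_eq_sq {p : ℕ} [Fact p.Prime] {f g : ℤ[X]}
    (hα : IsIntegral ℤ α) (hf : aeval α f = 0)
    (hg : Irreducible (g.map (Int.castRingHom (ZMod p))))
    (hfg : f.map (Int.castRingHom (ZMod p)) = g.map (Int.castRingHom (ZMod p)) ^ 2)
    (hni : ¬ IsIntegral ℤ (aeval α g / (p : K))) :
    IsSaturatedAt p (Subalgebra.toSubmodule (Algebra.adjoin ℤ {α})) := by
  intro z hz hpz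
  obtain ⟨P, hP⟩ := mem_adjoin_iff_exists_aeval.1 hpz
  have hp0 : (p : K) ≠ 0 := by exact_mod_cast (Fact.out : p.Prime).ne_zero
  rw [zsmul_eq_mul, Int.cast_natCast] at hP
  have hlift : ∀ a : (ZMod p)[X], ∃ b : ℤ[X], b.map (Int.castRingHom (ZMod p)) = a :=
    map_surjective _ (ZMod.ringHom_surjective _)
  -- If `g` lay in the ideal `(f, P)` modulo `p`, then, since `P(α) = p z`, `g(α)/p` would be an
  -- integral combination of `z` and powers of `α`.
  have contra : ∀ a b : (ZMod p)[X], g.map (Int.castRingHom (ZMod p)) =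
      a * f.map (Int.castRingHom (ZMod p)) + b * P.map (Int.castRingHom (ZMod p)) → False := by
    intro a b hab
    obtain ⟨a, rfl⟩ := hlift a
    obtain ⟨b, rfl⟩ := hlift b
    rw [← Polynomial.map_mul, ← Polynomial.map_mul, ← Polynomial.map_add] at hab
    obtain ⟨S, hS⟩ := exists_eq_add_of_map_eq hab
    apply hni
    have : aeval α g / (p : K) = aeval α b * z + aeval α S := by
      rw [hS]
      rw [map_add, map_add, map_mul, map_mul, map_mul, hf, hP, aeval_C, algebraMap_int_eq, eq_intCast,
        Int.cast_natCast]
      field_simp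
      ring
    rw [this]
    exact ((isIntegral_aeval hα b).mul hz).add (isIntegral_aeval hα S)
  -- As `f ≡ g²` with `g` irreducible, either `g²` divides `P` modulo `p`, so that `z` lies in
  -- `ℤ[α]`, or a Bézout relation multiplied by `g` puts `g` in `(f, P)`.
  by_cases h1 : g.map (Int.castRingHom (ZMod p)) ∣ P.map (Int.castRingHom (ZMod p))
  · obtain ⟨Q, hQ⟩ := h1
    by_cases h2 : g.map (Int.castRingHom (ZMod p)) ∣ Q
    · obtain ⟨R, hR⟩ := h2
      obtain ⟨R, rfl⟩ := hlift R
      have : P.map (Int.castRingHom (ZMod p)) = (f * R).map (Int.castRingHom (ZMod p)) := by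
        rw [Polynomial.map_mul, hfg, hQ, hR]; ring
      obtain ⟨S, hS⟩ := exists_eq_add_of_map_eq this
      refine mem_adjoin_iff_exists_aeval.2 ⟨S, mul_left_cancel₀ hp0 ?_⟩
      rw [← hP, hS]
      simp [hf]
    · obtain ⟨a, b, hab⟩ := hg.coprime_iff_not_dvd.2 h2
      refine (contra a b ?_).elim
      rw [hfg, hQ]
      linear_combination -(g.map (Int.castRingHom (ZMod p))) * hab
  · obtain ⟨a, b, hab⟩ := hg.coprime_iff_not_dvd.2 h1
    refine (contra a (b * g.map (Int.castRingHom (ZMod p))) ?_).elim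
    rw [hfg]
    linear_combination -(g.map (Int.castRingHom (ZMod p))) * hab

theorem not_isIntegral_half : ¬ IsIntegral ℤ (1 / 2 : K) := by
  intro h
  have e : (1 / 2 : K) = algebraMap ℚ K (1 / 2) := by simp
  rw [e, isIntegral_algebraMap_iff (algebraMap ℚ K).injective] at h
  obtain ⟨n, hn⟩ := IsIntegrallyClosed.isIntegral_iff.1 h
  have h2 : (n : ℚ) * 2 = 1 := by
    rw [show (n : ℚ) = 1 / 2 from hn]; norm_num
  have h3 : n * 2 = 1 := by exact_mod_cast h2
  omega

theorem irreducible_map_two_of_cubic {g : ℤ[X]} (hg : (g.map (Int.castRingHom (ZMod 2))).natDegree = 3)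
    (h0 : ¬ (2 : ℤ) ∣ g.eval 0) (h1 : ¬ (2 : ℤ) ∣ g.eval 1) :
    Irreducible (g.map (Int.castRingHom (ZMod 2))) := by
  refine irreducible_of_degree_le_three_of_not_isRoot (by rw [hg]; simp) fun x hx => ?_
  rw [IsRoot.def] at hx
  have key : ∀ n : ℤ, (n : ZMod 2) = x → (2 : ℤ) ∣ g.eval n := by
    rintro n rfl
    rw [show (n : ZMod 2) = Int.castRingHom (ZMod 2) n from rfl, eval_map, eval₂_hom, eq_intCast,
      ZMod.intCast_zmod_eq_zero_iff_dvd] at hx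
    exact_mod_cast hx
  fin_cases x
  · exact h0 (key 0 Int.cast_zero)
  · exact h1 (key 1 Int.cast_one)

end Saturation

/-! ### Integral elements with denominators 2, 3 and 9 -/

section Integrality

variable {K : Type*} [Field K] {m : ℤ} {α : K}

theorem isIntegral_poly (hα : IsIntegral ℤ α) (c₀ c₁ c₂ c₃ c₄ c₅ c₆ c₇ : ℤ) :
    IsIntegral ℤ (c₀ + c₁ * α + c₂ * α ^ 2 + c₃ * α ^ 3 + c₄ * α ^ 4 + c₅ * α ^ 5 + c₆ * α ^ 6
      + c₇ * α ^ 7 : K) := by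
  have h := isIntegral_aeval hα (C c₀ + C c₁ * X + C c₂ * X ^ 2 + C c₃ * X ^ 3 + C c₄ * X ^ 4
    + C c₅ * X ^ 5 + C c₆ * X ^ 6 + C c₇ * X ^ 7)
  simp only [map_add, map_mul, map_pow, aeval_C, aeval_X] at h
  simpa only [algebraMap_int_eq, eq_intCast] using h

theorem isIntegral_of_quadratic {u v b : K} (hu : IsIntegral ℤ u) (hv : IsIntegral ℤ v)
    (h : b ^ 2 + u * b + v = 0) : IsIntegral ℤ b := by
  let u' : integralClosure ℤ K := ⟨u, hu⟩
  let v' : integralClosure ℤ K := ⟨v, hv⟩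
  have hb : IsIntegral (integralClosure ℤ K) b := by
    refine ⟨X ^ 2 + C u' * X + C v', by monicity!, ?_⟩
    simpa [u', v', Algebra.algebraMap_ofSubsemiring_apply] using h
  exact isIntegral_trans b hb

section Three

variable [CharZero K]

theorem root_sub_one_ne_zero (hα : aeval α (simplestSexticPoly m) = 0) : α - 1 ≠ 0 := by
  intro h
  rw [aeval_simplestSexticPoly, sub_eq_zero.1 h] at hα
  have : (27 : K) = 0 := by linear_combination -hα
  norm_num at this

/-- Since `f(1) = -27`, dividing `z^6 f(1 + 3/z)` by `-27` gives a monic polynomial, and its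
coefficients are integers. -/
theorem isIntegral_three_div (hα : aeval α (simplestSexticPoly m) = 0) :
    IsIntegral ℤ (3 / (α - 1)) := by
  have h0 := root_sub_one_ne_zero hα
  rw [aeval_simplestSexticPoly] at hα
  refine ⟨X ^ 6 + C (12 + 2 * m) * X ^ 5 + C (45 + 15 * m) * X ^ 4 + C (60 + 40 * m) * X ^ 3
    + C (45 * m) * X ^ 2 - C (54 - 18 * m) * X - C 27, by monicity!, ?_⟩
  simp only [eval₂_add, eval₂_sub, eval₂_mul, eval₂_pow, eval₂_C, eval₂_X]
  simp only [algebraMap_int_eq, eq_intCast]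
  push_cast
  field_simp
  linear_combination -27 * hα

/-- With `z = 3 / (α - 1)`, the element `9 z` is a polynomial of degree `5` in `α`. -/
theorem nine_mul_three_div (hα : aeval α (simplestSexticPoly m) = 0) :
    9 * (3 / (α - 1)) = α ^ 5 + (1 - 2 * m) * α ^ 4 + (-14 - 7 * m) * α ^ 3 + (-34 - 7 * m) * α ^ 2
      + (-34 - 2 * m) * α - 28 := by
  have h0 := root_sub_one_ne_zero hα
  rw [aeval_simplestSexticPoly] at hα
  field_simp
  linear_combination -hα

/-- With `y = α - 1`, dividing `f = 0` by `y²` makes `27/y² - f'(1)/y` a quartic in `α`. Here `f'(1)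
= -9(12 + 2m)`, which explains the linear term in `z`. -/
theorem three_mul_three_div_sq (hα : aeval α (simplestSexticPoly m) = 0) :
    3 * ((3 / (α - 1)) ^ 2 + (12 + 2 * m) * (3 / (α - 1))) = α ^ 4 + (2 - 2 * m) * α ^ 3
      + (-12 - 9 * m) * α ^ 2 + (-46 - 16 * m) * α + (-80 - 18 * m) := by
  have h0 := root_sub_one_ne_zero hα
  rw [aeval_simplestSexticPoly] at hα
  field_simp
  linear_combination -hα

theorem isIntegral_quartic_div_three (hα : aeval α (simplestSexticPoly m) = 0) (c₀ c₁ c₂ c₃ : ℤ)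
    (h₀ : (3 : ℤ) ∣ c₀ - 1) (h₁ : (3 : ℤ) ∣ c₁ + m - 2) (h₂ : (3 : ℤ) ∣ c₂)
    (h₃ : (3 : ℤ) ∣ c₃ - m - 2) :
    IsIntegral ℤ ((c₀ + c₁ * α + c₂ * α ^ 2 + c₃ * α ^ 3 + α ^ 4) / 3 : K) := by
  obtain ⟨e₀, h₀⟩ := h₀
  obtain ⟨e₁, h₁⟩ := h₁
  obtain ⟨e₂, h₂⟩ := h₂
  obtain ⟨e₃, h₃⟩ := h₃
  obtain rfl : c₀ = 3 * e₀ + 1 := by omega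
  obtain rfl : c₁ = 3 * e₁ - m + 2 := by omega
  obtain rfl : c₃ = 3 * e₃ + m + 2 := by omega
  subst h₂
  have hz := isIntegral_three_div hα
  have hp := isIntegral_poly (isIntegral_of_root hα) (e₀ + 27 + 6 * m) (e₁ + 16 + 5 * m)
    (e₂ + 4 + 3 * m) (e₃ + m) 0 0 0 0
  have h12 := isIntegral_algebraMap (R := ℤ) (A := K) (x := 12 + 2 * m)
  convert! ((hz.pow 2).add (h12.mul hz)).add hp using 1
  have h := three_mul_three_div_sq hα
  simp only [algebraMap_int_eq, eq_intCast]
  push_cast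
  linear_combination (-1 / 3 : K) * h

/-- The congruences say that the element is `z + c(z² + (12 + 2m)z)` up to `ℤ[α]`. The parameter `c`
is the freedom of adding multiples of the quartic over 3. -/
theorem isIntegral_quintic_div_nine (hα : aeval α (simplestSexticPoly m) = 0) (c : ℤ)
    (c₀ c₁ c₂ c₃ c₄ : ℤ) (h₀ : (9 : ℤ) ∣ c₀ + 28 - 3 * c * (-80 - 18 * m))
    (h₁ : (9 : ℤ) ∣ c₁ + 34 + 2 * m - 3 * c * (-46 - 16 * m))
    (h₂ : (9 : ℤ) ∣ c₂ + 34 + 7 * m - 3 * c * (-12 - 9 * m))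
    (h₃ : (9 : ℤ) ∣ c₃ + 14 + 7 * m - 3 * c * (2 - 2 * m))
    (h₄ : (9 : ℤ) ∣ c₄ - 1 + 2 * m - 3 * c) :
    IsIntegral ℤ ((c₀ + c₁ * α + c₂ * α ^ 2 + c₃ * α ^ 3 + c₄ * α ^ 4 + α ^ 5) / 9 : K) := by
  obtain ⟨e₀, h₀⟩ := h₀
  obtain ⟨e₁, h₁⟩ := h₁
  obtain ⟨e₂, h₂⟩ := h₂
  obtain ⟨e₃, h₃⟩ := h₃
  obtain ⟨e₄, h₄⟩ := h₄
  have hz := isIntegral_three_div hα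
  have hp := isIntegral_poly (isIntegral_of_root hα) e₀ e₁ e₂ e₃ e₄ 0 0 0
  have h12 := isIntegral_algebraMap (R := ℤ) (A := K) (x := 12 + 2 * m)
  have hc := isIntegral_algebraMap (R := ℤ) (A := K) (x := c)
  convert! (hz.add (hc.mul ((hz.pow 2).add (h12.mul hz)))).add hp using 1
  have h₀' := congrArg (Int.cast (R := K)) h₀
  have h₁' := congrArg (Int.cast (R := K)) h₁
  have h₂' := congrArg (Int.cast (R := K)) h₂
  have h₃' := congrArg (Int.cast (R := K)) h₃
  have h₄' := congrArg (Int.cast (R := K)) h₄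
  have k1 := nine_mul_three_div hα
  have k2 := three_mul_three_div_sq hα
  simp only [algebraMap_int_eq, eq_intCast]
  push_cast at h₀' h₁' h₂' h₃' h₄' ⊢
  linear_combination (-1 / 9 : K) * k1 - (c / 3 : K) * k2 + (1 / 9 : K) * (h₀' + α * h₁'
    + α ^ 2 * h₂' + α ^ 3 * h₃' + α ^ 4 * h₄')

theorem isIntegral_cubic_div_two_of_even (hα : aeval α (simplestSexticPoly m) = 0)
    (hm : m % 4 = 0) : IsIntegral ℤ ((1 + α ^ 2 + α ^ 3) / 2 : K) := by
  obtain ⟨k, rfl⟩ : ∃ k, m = 4 * k := ⟨m / 4, by omega⟩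
  have hp := isIntegral_of_root hα
  -- As polynomials `f = g² + 2ug + 4v` with `g = 1 + x² + x³` and `u = x + x²`; dividing by 4 gives
  -- the quadratic for `g(α)/2`.
  refine isIntegral_of_quadratic (isIntegral_poly hp 0 1 1 0 0 0 0 0)
    (isIntegral_poly hp 0 (1 + 2 * k) (-1 + 5 * k) (-6) (-5 - 5 * k) (-1 - 2 * k) 0 0) ?_
  rw [aeval_simplestSexticPoly] at hα
  push_cast at hα ⊢
  linear_combination (1 / 4 : K) * hα

theorem isIntegral_cubic_div_two_of_odd (hα : aeval α (simplestSexticPoly m) = 0)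
    (hm : m % 4 = 1) : IsIntegral ℤ ((1 + α + α ^ 3) / 2 : K) := by
  obtain ⟨k, rfl⟩ : ∃ k, m = 4 * k + 1 := ⟨m / 4, by omega⟩
  have hp := isIntegral_of_root hα
  refine isIntegral_of_quadratic (isIntegral_poly hp 0 1 1 0 0 0 0 0)
    (isIntegral_poly hp 0 (1 + 2 * k) (5 * k) (-6) (-6 - 5 * k) (-1 - 2 * k) 0 0) ?_
  rw [aeval_simplestSexticPoly] at hα
  push_cast at hα ⊢
  linear_combination (1 / 4 : K) * hα

end Three

end Integrality

/-! ### Saturation of `ℤ[α]` at 2 -/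

section Two

variable {K : Type*} [Field K] [NumberField K] {m : ℤ} {α : K}

theorem not_isIntegral_cubic_div_two_of_even (hα : aeval α (simplestSexticPoly m) = 0)
    (hm : m % 4 = 2) : ¬ IsIntegral ℤ ((1 + α ^ 2 + α ^ 3) / 2 : K) := by
  intro h
  obtain ⟨k, rfl⟩ : ∃ k, m = 4 * k + 2 := ⟨m / 4, by omega⟩
  have hp := isIntegral_of_root hα
  -- Write `f = g² + 2h` and `b = g(α)/2`, so `b² = -h(α)/2`. The multipliers come from `x² h + (1 +
  -- x² + x⁴) g ≡ 1` modulo 2, so integrality of `b` would make `1/2` integral.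
  have h1 := (((hp.pow 2).mul (h.pow 2)).neg.add
    ((isIntegral_poly hp 1 0 1 0 1 0 0 0).mul h)).sub
    (isIntegral_poly hp 0 0 1 (3 + 2 * k) (3 + 5 * k) (-5) (-6 - 5 * k) (-1 - 2 * k))
  refine not_isIntegral_half (K := K) ?_
  convert! h1 using 1
  rw [aeval_simplestSexticPoly] at hα
  push_cast at hα ⊢
  linear_combination (α ^ 2 / 4 : K) * hα

theorem not_isIntegral_cubic_div_two_of_odd (hα : aeval α (simplestSexticPoly m) = 0)
    (hm : m % 4 = 3) : ¬ IsIntegral ℤ ((1 + α + α ^ 3) / 2 : K) := by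
  intro h
  obtain ⟨k, rfl⟩ : ∃ k, m = 4 * k + 3 := ⟨m / 4, by omega⟩
  have hp := isIntegral_of_root hα
  -- The Bézout relation is now `(1 + x²) h + (1 + x² + x⁴) g ≡ 1` modulo 2.
  have h1 := (((isIntegral_poly hp 1 0 1 0 0 0 0 0).mul (h.pow 2)).neg.add
    ((isIntegral_poly hp 1 0 1 0 1 0 0 0).mul h)).sub
    (isIntegral_poly hp 0 (3 + 2 * k) (4 + 5 * k) (-2 + 2 * k) (-4) (-6 - 2 * k) (-8 - 5 * k)
      (-1 - 2 * k))
  refine not_isIntegral_half (K := K) ?_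
  convert! h1 using 1
  rw [aeval_simplestSexticPoly] at hα
  push_cast at hα ⊢
  linear_combination ((α ^ 2 + 1) / 4 : K) * hα

theorem isSaturatedAt_two_adjoin_of_eq (hα : aeval α (simplestSexticPoly m) = 0) {g h : ℤ[X]}
    (hg : (g.map (Int.castRingHom (ZMod 2))).natDegree = 3) (h0 : ¬ (2 : ℤ) ∣ g.eval 0)
    (h1 : ¬ (2 : ℤ) ∣ g.eval 1) (hfg : simplestSexticPoly m = g ^ 2 + C 2 * h)
    (hni : ¬ IsIntegral ℤ (aeval α g / 2)) :
    IsSaturatedAt 2 (Subalgebra.toSubmodule (Algebra.adjoin ℤ {α})) := by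
  refine isSaturatedAt_adjoin_of_map_eq_sq (isIntegral_of_root hα) hα
    (irreducible_map_two_of_cubic hg h0 h1) ?_ (by exact_mod_cast hni)
  rw [hfg, Polynomial.map_add, Polynomial.map_mul, Polynomial.map_pow, map_C,
    show Int.castRingHom (ZMod 2) 2 = 0 from rfl, C_0, zero_mul, add_zero]

theorem isSaturatedAt_two_adjoin (hα : aeval α (simplestSexticPoly m) = 0)
    (hm : m % 4 = 2 ∨ m % 4 = 3) :
    IsSaturatedAt 2 (Subalgebra.toSubmodule (Algebra.adjoin ℤ {α})) := by
  rcases hm with hm | hm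
  · have hmap : (1 + X ^ 2 + X ^ 3 : ℤ[X]).map (Int.castRingHom (ZMod 2)) = 1 + X ^ 2 + X ^ 3 := by
      simp
    have hni := not_isIntegral_cubic_div_two_of_even hα hm
    obtain ⟨k, rfl⟩ : ∃ k, m = 4 * k + 2 := ⟨m / 4, by omega⟩
    refine isSaturatedAt_two_adjoin_of_eq (g := 1 + X ^ 2 + X ^ 3)
      (h := (5 + 4 * C k) * X + (4 + 10 * C k) * X ^ 2 - 11 * X ^ 3 + (-13 - 10 * C k) * X ^ 4
        + (-3 - 4 * C k) * X ^ 5) hα (by rw [hmap]; compute_degree!) (by simp) (by simp) ?_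
      (by simpa using hni)
    simp only [simplestSexticPoly, C_add, C_mul, C_ofNat]
    ring
  · have hmap : (1 + X + X ^ 3 : ℤ[X]).map (Int.castRingHom (ZMod 2)) = 1 + X + X ^ 3 := by
      simp
    have hni := not_isIntegral_cubic_div_two_of_odd hα hm
    obtain ⟨k, rfl⟩ : ∃ k, m = 4 * k + 3 := ⟨m / 4, by omega⟩
    refine isSaturatedAt_two_adjoin_of_eq (g := 1 + X + X ^ 3)
      (h := (5 + 4 * C k) * X + (7 + 10 * C k) * X ^ 2 - 11 * X ^ 3 + (-16 - 10 * C k) * X ^ 4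
        + (-3 - 4 * C k) * X ^ 5) hα (by rw [hmap]; compute_degree!) (by simp)
      (by simp) ?_ (by simpa using hni)
    simp only [simplestSexticPoly, C_add, C_mul, C_ofNat]
    ring

end Two

/-! ### Comparing `ℤ[α]` with `ℤ[3α - m]` -/

section Lattice

variable {K : Type*} [Field K] [NumberField K] {m : ℤ} {α : K}

omit [NumberField K] in
theorem adjoin_le_span_pow (hα : aeval α (simplestSexticPoly m) = 0) :
    Subalgebra.toSubmodule (Algebra.adjoin ℤ {α}) ≤
      Submodule.span ℤ (Set.range fun i : Fin 6 => α ^ (i : ℕ)) := by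
  intro z hz
  obtain ⟨P, rfl⟩ := mem_adjoin_iff_exists_aeval.1 hz
  have hf := monic_simplestSexticPoly m
  have hd : (P %ₘ simplestSexticPoly m).natDegree < 6 := by
    rw [← natDegree_simplestSexticPoly m]
    refine natDegree_modByMonic_lt _ hf fun h => ?_
    have := natDegree_simplestSexticPoly m
    rw [h] at this
    simp at this
  rw [← modByMonic_add_div P (simplestSexticPoly m), map_add, map_mul, hα, zero_mul, add_zero,
    aeval_eq_sum_range' hd]
  refine Submodule.sum_mem _ fun i hi => Submodule.smul_mem _ _ (Submodule.subset_span ?_)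
  exact ⟨⟨i, Finset.mem_range.1 hi⟩, rfl⟩

omit [NumberField K] in
theorem poly_mem_adjoin (c₀ c₁ c₂ c₃ c₄ c₅ : ℤ) :
    (c₀ + c₁ * α + c₂ * α ^ 2 + c₃ * α ^ 3 + c₄ * α ^ 4 + c₅ * α ^ 5 : K) ∈
      Subalgebra.toSubmodule (Algebra.adjoin ℤ {α}) := by
  refine mem_adjoin_iff_exists_aeval.2 ⟨C c₀ + C c₁ * X + C c₂ * X ^ 2 + C c₃ * X ^ 3
    + C c₄ * X ^ 4 + C c₅ * X ^ 5, ?_⟩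
  simp only [map_add, map_mul, map_pow, aeval_C, aeval_X]
  simp only [algebraMap_int_eq, eq_intCast]

theorem isSaturatedAt_adjoin_depressed (hq : Squarefree (simplestSexticQ m))
    (hα : aeval α (simplestSexticPoly m) = 0) (hK : IntermediateField.adjoin ℚ {α} = ⊤) {p : ℕ}
    (hp : p.Prime) (hpq : (p : ℤ) ∣ simplestSexticQ m) :
    IsSaturatedAt p (Subalgebra.toSubmodule (Algebra.adjoin ℤ {3 * α - (m : K)})) := by
  intro z hz hpz
  have h0 : aeval (3 * α - m) (depressedSexticPoly m) = 0 := by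
    rw [aeval_depressedSexticPoly, hα, mul_zero]
  have hint : IsIntegral ℤ (3 * α - m) := ⟨_, monic_depressedSexticPoly m, h0⟩
  refine mem_adjoin_of_smul_prime_smul_of_minpoly_isEisensteinAt
    (B := powerBasisOfAdjoin hint (adjoin_depressed hK)) (Nat.prime_iff_prime_int.1 hp) hint hz
    hpz ?_
  rw [powerBasisOfAdjoin_gen, minpoly_depressed hq hα]
  exact isEisensteinAt_depressedSexticPoly hq hp hpq

omit [NumberField K] in
theorem adjoin_depressed_le :
    Subalgebra.toSubmodule (Algebra.adjoin ℤ {3 * α - (m : K)}) ≤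
      Subalgebra.toSubmodule (Algebra.adjoin ℤ {α}) := by
  have h : Algebra.adjoin ℤ {3 * α - (m : K)} ≤ Algebra.adjoin ℤ {α} := by
    refine Algebra.adjoin_le (Set.singleton_subset_iff.2 ?_)
    have := poly_mem_adjoin (α := α) (-m) 3 0 0 0 0
    rw [Subalgebra.mem_toSubmodule] at this
    convert! this using 1
    push_cast
    ring
  exact h

omit [NumberField K] in
-- For `i ≤ 5`, `3^5 α^i = 3^(5 - i) (3α)^i`, and `3α` lies in `ℤ[3α - m]`. The factor is harmless
-- at primes other than 3.
theorem smul_mem_adjoin_depressed (hα : aeval α (simplestSexticPoly m) = 0) {z : K}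
    (hz : z ∈ Subalgebra.toSubmodule (Algebra.adjoin ℤ {α})) :
    (3 ^ 5 : ℤ) • z ∈ Subalgebra.toSubmodule (Algebra.adjoin ℤ {3 * α - (m : K)}) := by
  refine Submodule.span_induction (p := fun z _ => (3 ^ 5 : ℤ) • z ∈ Subalgebra.toSubmodule
    (Algebra.adjoin ℤ {3 * α - (m : K)})) ?_ (by simp) (fun x y _ _ hx hy => ?_)
    (fun a x _ hx => ?_) (adjoin_le_span_pow hα hz)
  · rintro _ ⟨i, rfl⟩
    rw [Subalgebra.mem_toSubmodule]
    have h1 : 3 * α ∈ Algebra.adjoin ℤ {3 * α - (m : K)} := by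
      have := add_mem (Algebra.self_mem_adjoin_singleton ℤ (3 * α - (m : K)))
        (intCast_mem (Algebra.adjoin ℤ {3 * α - (m : K)}) m)
      rwa [sub_add_cancel] at this
    have h2 := mul_mem (natCast_mem (Algebra.adjoin ℤ {3 * α - (m : K)}) (3 ^ (5 - (i : ℕ))))
      (pow_mem h1 i)
    convert! h2 using 1
    have h3 : (3 : K) ^ 5 = 3 ^ (5 - (i : ℕ)) * 3 ^ (i : ℕ) := by
      rw [← pow_add, Nat.sub_add_cancel (by omega)]
    rw [zsmul_eq_mul, mul_pow, ← mul_assoc]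
    push_cast
    rw [← h3]
    norm_num
  · rw [smul_add]; exact add_mem hx hy
  · rw [smul_comm]; exact Submodule.smul_mem _ _ hx

end Lattice

/-! ### Triangular lattices between `ℤ[α]` and the ring of integers -/

section Main

variable {K : Type*} [Field K] [NumberField K] {m : ℤ} {α : K}

/-- The family `1, α, α², …` made triangular with denominators `d₃, d₄, d₅`. -/
def triangularFamily (α : K) (d₃ d₄ d₅ a₀ a₁ a₂ b₀ b₁ b₂ b₃ c₀ c₁ c₂ c₃ c₄ : ℤ) : Fin 6 → K :=
  ![1, α, α ^ 2, (a₀ + a₁ * α + a₂ * α ^ 2 + α ^ 3) / d₃,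
    (b₀ + b₁ * α + b₂ * α ^ 2 + b₃ * α ^ 3 + α ^ 4) / d₄,
    (c₀ + c₁ * α + c₂ * α ^ 2 + c₃ * α ^ 3 + c₄ * α ^ 4 + α ^ 5) / d₅]

section Triangular

variable (d₃ d₄ d₅ a₀ a₁ a₂ b₀ b₁ b₂ b₃ c₀ c₁ c₂ c₃ c₄ : ℤ)

theorem discr_triangularFamily (hq : Squarefree (simplestSexticQ m))
    (hα : aeval α (simplestSexticPoly m) = 0) (hK : IntermediateField.adjoin ℚ {α} = ⊤) :
    Algebra.discr ℚ (triangularFamily α d₃ d₄ d₅ a₀ a₁ a₂ b₀ b₁ b₂ b₃ c₀ c₁ c₂ c₃ c₄) =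
      ((d₃ * d₄ * d₅ : ℚ)⁻¹) ^ 2 * (6 ^ 6 * (simplestSexticQ m : ℚ) ^ 5) := by
  let P : Matrix (Fin 6) (Fin 6) ℚ := !![1, 0, 0, 0, 0, 0; 0, 1, 0, 0, 0, 0; 0, 0, 1, 0, 0, 0;
    a₀ / d₃, a₁ / d₃, a₂ / d₃, 1 / d₃, 0, 0; b₀ / d₄, b₁ / d₄, b₂ / d₄, b₃ / d₄, 1 / d₄, 0;
    c₀ / d₅, c₁ / d₅, c₂ / d₅, c₃ / d₅, c₄ / d₅, 1 / d₅]
  have hP : P.det = (d₃ * d₄ * d₅ : ℚ)⁻¹ := by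
    rw [Matrix.det_of_isLowerTriangular]
    · simp [P, Fin.prod_univ_succ]
      ring
    · intro i j hij
      have hij : i < j := hij
      fin_cases i <;> fin_cases j <;> first | rfl | simp at hij
  have hv : triangularFamily α d₃ d₄ d₅ a₀ a₁ a₂ b₀ b₁ b₂ b₃ c₀ c₁ c₂ c₃ c₄ =
      Matrix.mulVec (P.map (algebraMap ℚ K)) (fun i : Fin 6 => α ^ (i : ℕ)) := by
    ext i
    fin_cases i <;>
      simp [triangularFamily, P, Matrix.mulVec, dotProduct, Fin.sum_univ_succ] <;> ring
  rw [hv, Algebra.discr_of_matrix_mulVec, hP, discr_pow_root hq hα hK]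

variable {d₃ d₄ d₅ a₀ a₁ a₂ b₀ b₁ b₂ b₃ c₀ c₁ c₂ c₃ c₄}

theorem adjoin_le_span_triangularFamily (hα : aeval α (simplestSexticPoly m) = 0)
    (h₃ : d₃ ≠ 0) (h₄ : d₄ ≠ 0) (h₅ : d₅ ≠ 0) :
    Subalgebra.toSubmodule (Algebra.adjoin ℤ {α}) ≤ Submodule.span ℤ (Set.range
      (triangularFamily α d₃ d₄ d₅ a₀ a₁ a₂ b₀ b₁ b₂ b₃ c₀ c₁ c₂ c₃ c₄)) := by
  set v := triangularFamily α d₃ d₄ d₅ a₀ a₁ a₂ b₀ b₁ b₂ b₃ c₀ c₁ c₂ c₃ c₄ with hv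
  set M := Submodule.span ℤ (Set.range v)
  have h₃' : (d₃ : K) ≠ 0 := by exact_mod_cast h₃
  have h₄' : (d₄ : K) ≠ 0 := by exact_mod_cast h₄
  have h₅' : (d₅ : K) ≠ 0 := by exact_mod_cast h₅
  have hm : ∀ i (a : ℤ), (a : K) * v i ∈ M := fun i a => by
    rw [← zsmul_eq_mul]
    exact M.smul_mem _ (Submodule.subset_span ⟨i, rfl⟩)
  have hmul : ∀ {x : K} (a : ℤ), x ∈ M → (a : K) * x ∈ M := fun a hx => by
    rw [← zsmul_eq_mul]
    exact M.smul_mem _ hx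
  have k0 : (1 : K) ∈ M := by simpa [v, triangularFamily] using hm 0 1
  have k1 : α ∈ M := by simpa [v, triangularFamily] using hm 1 1
  have k2 : α ^ 2 ∈ M := by simpa [v, triangularFamily] using hm 2 1
  have k3 : α ^ 3 ∈ M := by
    have h := sub_mem (sub_mem (sub_mem (hm 3 d₃) (hmul a₀ k0)) (hmul a₁ k1)) (hmul a₂ k2)
    convert! h using 1
    simp [v, triangularFamily]
    field_simp
    ring
  have k4 : α ^ 4 ∈ M := by
    have h := sub_mem (sub_mem (sub_mem (sub_mem (hm 4 d₄) (hmul b₀ k0)) (hmul b₁ k1))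
      (hmul b₂ k2)) (hmul b₃ k3)
    convert! h using 1
    simp [v, triangularFamily]
    field_simp
    ring
  have k5 : α ^ 5 ∈ M := by
    have h := sub_mem (sub_mem (sub_mem (sub_mem (sub_mem (hm 5 d₅) (hmul c₀ k0)) (hmul c₁ k1))
      (hmul c₂ k2)) (hmul c₃ k3)) (hmul c₄ k4)
    convert! h using 1
    simp [v, triangularFamily]
    field_simp
    ring
  refine (adjoin_le_span_pow hα).trans (Submodule.span_le.2 ?_)
  rintro _ ⟨i, rfl⟩
  fin_cases i
  · simpa using k0
  · simpa using k1
  · exact k2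
  · exact k3
  · exact k4
  · exact k5

theorem smul_mem_adjoin_of_mem_span_triangularFamily (h₃ : d₃ ≠ 0) (h₄ : d₄ ≠ 0) (h₅ : d₅ ≠ 0)
    {z : K} (hz : z ∈ Submodule.span ℤ (Set.range
      (triangularFamily α d₃ d₄ d₅ a₀ a₁ a₂ b₀ b₁ b₂ b₃ c₀ c₁ c₂ c₃ c₄))) :
    (d₃ * d₄ * d₅) • z ∈ Subalgebra.toSubmodule (Algebra.adjoin ℤ {α}) := by
  have h₃' : (d₃ : K) ≠ 0 := by exact_mod_cast h₃
  have h₄' : (d₄ : K) ≠ 0 := by exact_mod_cast h₄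
  have h₅' : (d₅ : K) ≠ 0 := by exact_mod_cast h₅
  refine Submodule.span_induction (p := fun z _ => (d₃ * d₄ * d₅) • z ∈ Subalgebra.toSubmodule
    (Algebra.adjoin ℤ {α})) ?_ (by simp) (fun x y _ _ hx hy => ?_) (fun a x _ hx => ?_) hz
  · rintro _ ⟨i, rfl⟩
    fin_cases i
    · convert! poly_mem_adjoin (α := α) (d₃ * d₄ * d₅) 0 0 0 0 0 using 1
      simp [triangularFamily]
    · convert! poly_mem_adjoin (α := α) 0 (d₃ * d₄ * d₅) 0 0 0 0 using 1
      simp [triangularFamily]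
    · convert! poly_mem_adjoin (α := α) 0 0 (d₃ * d₄ * d₅) 0 0 0 using 1
      simp [triangularFamily]
    · convert! Submodule.smul_mem _ (d₄ * d₅) (poly_mem_adjoin (α := α) a₀ a₁ a₂ 1 0 0) using 1
      simp [triangularFamily]
      field_simp
    · convert! Submodule.smul_mem _ (d₃ * d₅) (poly_mem_adjoin (α := α) b₀ b₁ b₂ b₃ 1 0) using 1
      simp [triangularFamily]
      field_simp
    · convert! Submodule.smul_mem _ (d₃ * d₄) (poly_mem_adjoin (α := α) c₀ c₁ c₂ c₃ c₄ 1) using 1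
      simp [triangularFamily]
      field_simp
  · rw [smul_add]; exact add_mem hx hy
  · rw [smul_comm]; exact Submodule.smul_mem _ _ hx

theorem isSaturatedAt_triangularFamily (hq : Squarefree (simplestSexticQ m))
    (hα : aeval α (simplestSexticPoly m) = 0) (hK : IntermediateField.adjoin ℚ {α} = ⊤)
    (hN : d₃ * d₄ * d₅ ∣ 6 ^ 3) {p : ℕ} (hp : p.Prime) (hpq : (p : ℤ) ∣ simplestSexticQ m) :
    IsSaturatedAt p (Submodule.span ℤ (Set.range
      (triangularFamily α d₃ d₄ d₅ a₀ a₁ a₂ b₀ b₁ b₂ b₃ c₀ c₁ c₂ c₃ c₄))) := by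
  have hN0 : d₃ * d₄ * d₅ ≠ 0 := ne_zero_of_dvd_ne_zero (by norm_num) hN
  obtain ⟨⟨h₃, h₄⟩, h₅⟩ : (d₃ ≠ 0 ∧ d₄ ≠ 0) ∧ d₅ ≠ 0 := by simpa using hN0
  obtain ⟨hp2, hp3⟩ := prime_ne_of_dvd (not_three_dvd_of_squarefree hq) hpq
  have c2 : IsCoprime (2 : ℤ) p := by
    exact_mod_cast Nat.isCoprime_iff_coprime.2 ((Nat.coprime_primes Nat.prime_two hp).2 hp2.symm)
  have c3 : IsCoprime (3 : ℤ) p := by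
    exact_mod_cast Nat.isCoprime_iff_coprime.2 ((Nat.coprime_primes Nat.prime_three hp).2 hp3.symm)
  have c6 : IsCoprime (6 ^ 3 : ℤ) p := by
    rw [show (6 : ℤ) = 2 * 3 by norm_num]
    exact (c2.mul_left c3).pow_left
  refine (isSaturatedAt_adjoin_depressed hq hα hK hp hpq).of_le
    (adjoin_depressed_le.trans (adjoin_le_span_triangularFamily hα h₃ h₄ h₅))
    (N := 3 ^ 5 * (d₃ * d₄ * d₅)) (c3.pow_left.mul_left (c6.of_isCoprime_of_dvd_left hN)) ?_
  intro z hz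
  rw [mul_smul]
  exact smul_mem_adjoin_depressed hα (smul_mem_adjoin_of_mem_span_triangularFamily h₃ h₄ h₅ hz)

theorem exists_integralBasis_triangularFamily (hq : Squarefree (simplestSexticQ m))
    (hα : aeval α (simplestSexticPoly m) = 0) (hK : IntermediateField.adjoin ℚ {α} = ⊤)
    (hint : ∀ i, IsIntegral ℤ
      (triangularFamily α d₃ d₄ d₅ a₀ a₁ a₂ b₀ b₁ b₂ b₃ c₀ c₁ c₂ c₃ c₄ i))
    (h : d₃ * d₄ * d₅ = 6 ^ 3 ∨ d₃ * d₄ * d₅ = 3 ^ 3 ∧ (m % 4 = 2 ∨ m % 4 = 3)) :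
    (∃ B : Module.Basis (Fin 6) ℤ (𝓞 K), ∀ i, (B i : K) =
      triangularFamily α d₃ d₄ d₅ a₀ a₁ a₂ b₀ b₁ b₂ b₃ c₀ c₁ c₂ c₃ c₄ i) ∧
    NumberField.discr K = (if d₃ * d₄ * d₅ = 6 ^ 3 then 1 else 2 ^ 6) * simplestSexticQ m ^ 5 := by
  set v := triangularFamily α d₃ d₄ d₅ a₀ a₁ a₂ b₀ b₁ b₂ b₃ c₀ c₁ c₂ c₃ c₄ with hv
  have hN : d₃ * d₄ * d₅ ∣ 6 ^ 3 := by
    rcases h with h | ⟨h, -⟩ <;> rw [h]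
    norm_num
  have hN0 : d₃ * d₄ * d₅ ≠ 0 := ne_zero_of_dvd_ne_zero (by norm_num) hN
  obtain ⟨⟨h₃, h₄⟩, h₅⟩ : (d₃ ≠ 0 ∧ d₄ ≠ 0) ∧ d₅ ≠ 0 := by simpa using hN0
  have hd : Algebra.discr ℚ v =
      (((if d₃ * d₄ * d₅ = 6 ^ 3 then 1 else 2 ^ 6) * simplestSexticQ m ^ 5 : ℤ) : ℚ) := by
    rw [hv, discr_triangularFamily _ _ _ _ _ _ _ _ _ _ _ _ _ _ _ hq hα hK]
    rcases h with h | ⟨h, -⟩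
    · have h' : (d₃ * d₄ * d₅ : ℚ) = 6 ^ 3 := by exact_mod_cast h
      rw [h', if_pos h]
      push_cast
      ring
    · have h' : (d₃ * d₄ * d₅ : ℚ) = 3 ^ 3 := by exact_mod_cast h
      rw [h', if_neg (by rw [h]; norm_num)]
      push_cast
      ring
  have hq0 := simplestSexticQ_pos m
  -- Independence is read off from the nonvanishing discriminant.
  have hli : LinearIndependent ℚ v := by
    by_contra hli
    rw [Algebra.discr_zero_of_not_linearIndependent ℚ hli] at hd
    have hd' := hd.symm
    rw [Int.cast_eq_zero] at hd'
    split_ifs at hd' <;> simp at hd' <;> omega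
  have hb : ∃ b : Module.Basis (Fin 6) ℚ K, ⇑b = v :=
    ⟨basisOfLinearIndependentOfCardEqFinrank hli (by simp [finrank_eq_six hq hα hK]), by simp⟩
  obtain ⟨b, hb⟩ := hb
  rw [← hb] at hd hint ⊢
  refine exists_integralBasis_of_isSaturatedAt b hint _ hd fun p hp hpD => ?_
  have hp' := Nat.prime_iff_prime_int.1 hp
  rw [hb]
  -- The prime 3 needs no saturation argument: dividing `6^6 q^5` by `27²` or `216²` leaves `2^6
  -- q^5` or `q^5`.
  rcases hp'.dvd_or_dvd hpD with h1 | h1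
  · rcases h with h | ⟨h, hm⟩
    · rw [if_pos h] at h1
      exact (hp'.not_dvd_one h1).elim
    · rw [if_neg (by rw [h]; norm_num)] at h1
      have h2 : p ∣ 2 := by exact_mod_cast hp'.dvd_of_dvd_pow h1
      obtain rfl := (Nat.prime_dvd_prime_iff_eq hp Nat.prime_two).1 h2
      refine (isSaturatedAt_two_adjoin hα hm).of_le
        (adjoin_le_span_triangularFamily hα h₃ h₄ h₅) (N := d₃ * d₄ * d₅) ?_
        fun z hz => smul_mem_adjoin_of_mem_span_triangularFamily h₃ h₄ h₅ hz
      rw [h]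
      exact ⟨1, -13, by norm_num⟩
  · exact isSaturatedAt_triangularFamily hq hα hK hN hp (hp'.dvd_of_dvd_pow h1)

end Triangular

end Main

/-! ### The two shapes of basis -/

section Families

variable {K : Type*} [Field K] [NumberField K] {m : ℤ} {α : K}
  {b₀ b₁ b₂ b₃ c₀ c₁ c₂ c₃ c₄ : ℤ}

/-- The congruences say that the numerator is a multiple of `1 + x² + x³` modulo 2; the cofactor is
read off from `c₀, c₄, c₅`. -/
theorem isIntegral_div_two_of_even (hα : aeval α (simplestSexticPoly m) = 0) (hm : m % 4 = 0)
    (c₀ c₁ c₂ c₃ c₄ c₅ : ℤ) (h₁ : 2 ∣ c₁ - c₄ - c₅) (h₂ : 2 ∣ c₂ - c₀ - c₅)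
    (h₃ : 2 ∣ c₃ - c₀ - c₄ - c₅) :
    IsIntegral ℤ ((c₀ + c₁ * α + c₂ * α ^ 2 + c₃ * α ^ 3 + c₄ * α ^ 4 + c₅ * α ^ 5) / 2 : K) := by
  obtain ⟨e₁, h₁⟩ := h₁
  obtain ⟨e₂, h₂⟩ := h₂
  obtain ⟨e₃, h₃⟩ := h₃
  obtain rfl : c₁ = 2 * e₁ + c₄ + c₅ := by omega
  obtain rfl : c₂ = 2 * e₂ + c₀ + c₅ := by omega
  obtain rfl : c₃ = 2 * e₃ + c₀ + c₄ + c₅ := by omega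
  have hp := isIntegral_of_root hα
  convert! ((isIntegral_poly hp c₀ (c₄ - c₅) c₅ 0 0 0 0 0).mul
    (isIntegral_cubic_div_two_of_even hα hm)).add
    (isIntegral_poly hp 0 (e₁ + c₅) e₂ (e₃ + c₅) 0 0 0 0) using 1
  push_cast
  ring

/-- As in the even case, with the cubic `1 + x + x³` and cofactor `c₀ + c₄ x + c₅ x²`. -/
theorem isIntegral_div_two_of_odd (hα : aeval α (simplestSexticPoly m) = 0) (hm : m % 4 = 1)
    (c₀ c₁ c₂ c₃ c₄ c₅ : ℤ) (h₁ : 2 ∣ c₁ - c₀ - c₄) (h₂ : 2 ∣ c₂ - c₄ - c₅)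
    (h₃ : 2 ∣ c₃ - c₀ - c₅) :
    IsIntegral ℤ ((c₀ + c₁ * α + c₂ * α ^ 2 + c₃ * α ^ 3 + c₄ * α ^ 4 + c₅ * α ^ 5) / 2 : K) := by
  obtain ⟨e₁, h₁⟩ := h₁
  obtain ⟨e₂, h₂⟩ := h₂
  obtain ⟨e₃, h₃⟩ := h₃
  obtain rfl : c₁ = 2 * e₁ + c₀ + c₄ := by omega
  obtain rfl : c₂ = 2 * e₂ + c₄ + c₅ := by omega
  obtain rfl : c₃ = 2 * e₃ + c₀ + c₅ := by omega
  have hp := isIntegral_of_root hα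
  convert! ((isIntegral_poly hp c₀ c₄ c₅ 0 0 0 0 0).mul
    (isIntegral_cubic_div_two_of_odd hα hm)).add
    (isIntegral_poly hp 0 e₁ e₂ e₃ 0 0 0 0) using 1
  push_cast
  ring

/-- The case of odd index: the denominators are `1, 3, 9`. -/
theorem exists_integralBasis_of_index_twentySeven (hq : Squarefree (simplestSexticQ m))
    (hα : aeval α (simplestSexticPoly m) = 0) (hK : IntermediateField.adjoin ℚ {α} = ⊤)
    (hm : m % 4 = 2 ∨ m % 4 = 3)
    (hb : IsIntegral ℤ ((b₀ + b₁ * α + b₂ * α ^ 2 + b₃ * α ^ 3 + α ^ 4) / 3 : K))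
    (hc : IsIntegral ℤ ((c₀ + c₁ * α + c₂ * α ^ 2 + c₃ * α ^ 3 + c₄ * α ^ 4 + α ^ 5) / 9 : K))
    {w : Fin 6 → K} {D : ℤ}
    (hw : w = ![1, α, α ^ 2, α ^ 3, (b₀ + b₁ * α + b₂ * α ^ 2 + b₃ * α ^ 3 + α ^ 4) / 3,
      (c₀ + c₁ * α + c₂ * α ^ 2 + c₃ * α ^ 3 + c₄ * α ^ 4 + α ^ 5) / 9])
    (hD : D = 2 ^ 6 * simplestSexticQ m ^ 5) :
    (∃ B : Module.Basis (Fin 6) ℤ (𝓞 K), ∀ i, (B i : K) = w i) ∧ NumberField.discr K = D := by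
  have hp := isIntegral_of_root hα
  have hw' : w = triangularFamily α 1 3 9 0 0 0 b₀ b₁ b₂ b₃ c₀ c₁ c₂ c₃ c₄ := by
    rw [hw]
    simp [triangularFamily]
  have hi : ∀ i, IsIntegral ℤ (w i) := by
    rw [hw]
    intro i
    fin_cases i
    exacts [isIntegral_one, hp, hp.pow 2, hp.pow 3, hb, hc]
  rw [hw'] at hi ⊢
  have h := exists_integralBasis_triangularFamily hq hα hK hi (Or.inr ⟨by norm_num, hm⟩)
  rwa [if_neg (by norm_num), ← hD] at h

/-- The case of even index: the denominators are `2, 6, 18`. -/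
theorem exists_integralBasis_of_index_twoHundredSixteen (hq : Squarefree (simplestSexticQ m))
    (hα : aeval α (simplestSexticPoly m) = 0) (hK : IntermediateField.adjoin ℚ {α} = ⊤)
    {a₀ a₁ a₂ : ℤ} (ha : IsIntegral ℤ
      ((a₀ + a₁ * α + a₂ * α ^ 2 + (1 : ℤ) * α ^ 3 + (0 : ℤ) * α ^ 4 + (0 : ℤ) * α ^ 5) / 2 : K))
    (hb : IsIntegral ℤ
      ((b₀ + b₁ * α + b₂ * α ^ 2 + b₃ * α ^ 3 + (1 : ℤ) * α ^ 4 + (0 : ℤ) * α ^ 5) / 2 : K))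
    (hb' : IsIntegral ℤ ((b₀ + b₁ * α + b₂ * α ^ 2 + b₃ * α ^ 3 + α ^ 4) / 3 : K))
    (hc : IsIntegral ℤ
      ((c₀ + c₁ * α + c₂ * α ^ 2 + c₃ * α ^ 3 + c₄ * α ^ 4 + (1 : ℤ) * α ^ 5) / 2 : K))
    (hc' : IsIntegral ℤ ((c₀ + c₁ * α + c₂ * α ^ 2 + c₃ * α ^ 3 + c₄ * α ^ 4 + α ^ 5) / 9 : K))
    {w : Fin 6 → K} {D : ℤ}
    (hw : w = ![1, α, α ^ 2, (a₀ + a₁ * α + a₂ * α ^ 2 + α ^ 3) / 2,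
      (b₀ + b₁ * α + b₂ * α ^ 2 + b₃ * α ^ 3 + α ^ 4) / 6,
      (c₀ + c₁ * α + c₂ * α ^ 2 + c₃ * α ^ 3 + c₄ * α ^ 4 + α ^ 5) / 18])
    (hD : D = simplestSexticQ m ^ 5) :
    (∃ B : Module.Basis (Fin 6) ℤ (𝓞 K), ∀ i, (B i : K) = w i) ∧ NumberField.discr K = D := by
  have hp := isIntegral_of_root hα
  have hw' : w = triangularFamily α 2 6 18 a₀ a₁ a₂ b₀ b₁ b₂ b₃ c₀ c₁ c₂ c₃ c₄ := by
    rw [hw]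
    simp [triangularFamily]
  have hi : ∀ i, IsIntegral ℤ (w i) := by
    rw [hw]
    intro i
    fin_cases i
    · exact isIntegral_one
    · exact hp
    · exact hp.pow 2
    · convert! ha using 1
      simp
    -- Partial fractions: `1/6 = 1/2 - 1/3`, and below `1/18 = 1/2 - 4/9`.
    · convert! hb.sub hb' using 1
      simp
      ring
    · convert! hc.sub (hc'.nsmul 4) using 1
      simp
      ring
  rw [hw'] at hi ⊢
  have h := exists_integralBasis_triangularFamily hq hα hK hi (Or.inl (by norm_num))
  rwa [if_pos (by norm_num), one_mul, ← hD] at h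

end Families

/-! ### The table of residues modulo 36 -/

theorem theorem1 (m : ℤ) (hm : m ≠ -8 ∧ m ≠ -3 ∧ m ≠ 0 ∧ m ≠ 5)
    (hq : Squarefree (simplestSexticQ m))
    (r : ℕ) (hr1 : 1 ≤ r) (hr36 : r ≤ 36) (k : ℤ) (hrk : m = (r : ℤ) + 36 * k)
    {K : Type*} [Field K] [NumberField K] (α : K)
    (hα : aeval α (simplestSexticPoly m) = 0)
    (hK : IntermediateField.adjoin ℚ {α} = ⊤) :
    ¬ 3 ∣ r ∧
    (∃ B : Module.Basis (Fin 6) ℤ (𝓞 K), ∀ i, (B i : K) = simplestSexticBasis r α i) ∧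
    NumberField.discr K = simplestSexticDiscr r m := by
  have h3 := not_three_dvd_of_squarefree hq
  have hr3 : ¬ 3 ∣ r := by omega
  refine ⟨hr3, ?_⟩
  have hb := isIntegral_quartic_div_three hα
  -- In each case below the first argument of `hc` is the `c` mod 3 with `3c ≡ c₄ - 1 + 2m` modulo
  -- 9.
  have hc := isIntegral_quintic_div_nine hα
  interval_cases r <;> try omega
  · have hd := isIntegral_div_two_of_odd hα (by omega)
    exact exists_integralBasis_of_index_twoHundredSixteen hq hα hK
      (hd 1 1 0 1 0 0 (by omega) (by omega) (by omega))
      (hd 4 1 3 0 1 0 (by omega) (by omega) (by omega))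
      (hb 4 1 3 0 (by omega) (by omega) (by omega) (by omega))
      (hd 11 3 13 6 2 1 (by omega) (by omega) (by omega))
      (hc 1 11 3 13 6 2 (by omega) (by omega) (by omega) (by omega) (by omega))
      (by simp [simplestSexticBasis]) (by simp [simplestSexticDiscr])
  · exact exists_integralBasis_of_index_twentySeven hq hα hK (by omega)
      (hb 1 0 0 1 (by omega) (by omega) (by omega) (by omega))
      (hc 1 2 7 6 2 0 (by omega) (by omega) (by omega) (by omega) (by omega))
      (by simp [simplestSexticBasis]) (by simp [simplestSexticDiscr])
  · have hd := isIntegral_div_two_of_even hα (by omega)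
    exact exists_integralBasis_of_index_twoHundredSixteen hq hα hK
      (hd 1 0 1 1 0 0 (by omega) (by omega) (by omega))
      (hd 1 1 3 0 1 0 (by omega) (by omega) (by omega))
      (hb 1 1 3 0 (by omega) (by omega) (by omega) (by omega))
      (hd 8 3 1 3 2 1 (by omega) (by omega) (by omega))
      (hc 0 8 3 1 3 2 (by omega) (by omega) (by omega) (by omega) (by omega))
      (by simp [simplestSexticBasis]) (by simp [simplestSexticDiscr])
  · have hd := isIntegral_div_two_of_odd hα (by omega)
    exact exists_integralBasis_of_index_twoHundredSixteen hq hα hK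
      (hd 1 1 0 1 0 0 (by omega) (by omega) (by omega))
      (hd 1 0 3 1 1 0 (by omega) (by omega) (by omega))
      (hb 1 0 3 1 (by omega) (by omega) (by omega) (by omega))
      (hd 8 10 3 5 0 1 (by omega) (by omega) (by omega))
      (hc 0 8 10 3 5 0 (by omega) (by omega) (by omega) (by omega) (by omega))
      (by simp [simplestSexticBasis]) (by simp [simplestSexticDiscr])
  · exact exists_integralBasis_of_index_twentySeven hq hα hK (by omega)
      (hb 1 1 0 0 (by omega) (by omega) (by omega) (by omega))
      (hc 2 5 3 7 0 2 (by omega) (by omega) (by omega) (by omega) (by omega))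
      (by simp [simplestSexticBasis]) (by simp [simplestSexticDiscr])
  · have hd := isIntegral_div_two_of_even hα (by omega)
    exact exists_integralBasis_of_index_twoHundredSixteen hq hα hK
      (hd 1 0 1 1 0 0 (by omega) (by omega) (by omega))
      (hd 4 3 0 1 1 0 (by omega) (by omega) (by omega))
      (hb 4 3 0 1 (by omega) (by omega) (by omega) (by omega))
      (hd 5 13 0 8 0 1 (by omega) (by omega) (by omega))
      (hc 2 5 13 0 8 0 (by omega) (by omega) (by omega) (by omega) (by omega))
      (by simp [simplestSexticBasis]) (by simp [simplestSexticDiscr])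
  · exact exists_integralBasis_of_index_twentySeven hq hα hK (by omega)
      (hb 1 1 0 0 (by omega) (by omega) (by omega) (by omega))
      (hc 1 2 3 4 6 2 (by omega) (by omega) (by omega) (by omega) (by omega))
      (by simp [simplestSexticBasis]) (by simp [simplestSexticDiscr])
  · exact exists_integralBasis_of_index_twentySeven hq hα hK (by omega)
      (hb 1 0 0 1 (by omega) (by omega) (by omega) (by omega))
      (hc 1 2 7 6 2 0 (by omega) (by omega) (by omega) (by omega) (by omega))
      (by simp [simplestSexticBasis]) (by simp [simplestSexticDiscr])
  · have hd := isIntegral_div_two_of_odd hα (by omega)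
    exact exists_integralBasis_of_index_twoHundredSixteen hq hα hK
      (hd 1 1 0 1 0 0 (by omega) (by omega) (by omega))
      (hd 4 1 3 0 1 0 (by omega) (by omega) (by omega))
      (hb 4 1 3 0 (by omega) (by omega) (by omega) (by omega))
      (hd 8 12 1 3 2 1 (by omega) (by omega) (by omega))
      (hc 0 8 12 1 3 2 (by omega) (by omega) (by omega) (by omega) (by omega))
      (by simp [simplestSexticBasis]) (by simp [simplestSexticDiscr])
  · exact exists_integralBasis_of_index_twentySeven hq hα hK (by omega)
      (hb 1 0 0 1 (by omega) (by omega) (by omega) (by omega))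
      (hc 0 8 1 3 5 0 (by omega) (by omega) (by omega) (by omega) (by omega))
      (by simp [simplestSexticBasis]) (by simp [simplestSexticDiscr])
  · have hd := isIntegral_div_two_of_even hα (by omega)
    exact exists_integralBasis_of_index_twoHundredSixteen hq hα hK
      (hd 1 0 1 1 0 0 (by omega) (by omega) (by omega))
      (hd 1 1 3 0 1 0 (by omega) (by omega) (by omega))
      (hb 1 1 3 0 (by omega) (by omega) (by omega) (by omega))
      (hd 5 3 16 0 2 1 (by omega) (by omega) (by omega))
      (hc 2 5 3 16 0 2 (by omega) (by omega) (by omega) (by omega) (by omega))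
      (by simp [simplestSexticBasis]) (by simp [simplestSexticDiscr])
  · have hd := isIntegral_div_two_of_odd hα (by omega)
    exact exists_integralBasis_of_index_twoHundredSixteen hq hα hK
      (hd 1 1 0 1 0 0 (by omega) (by omega) (by omega))
      (hd 1 0 3 1 1 0 (by omega) (by omega) (by omega))
      (hb 1 0 3 1 (by omega) (by omega) (by omega) (by omega))
      (hd 5 13 9 8 0 1 (by omega) (by omega) (by omega))
      (hc 2 5 13 9 8 0 (by omega) (by omega) (by omega) (by omega) (by omega))
      (by simp [simplestSexticBasis]) (by simp [simplestSexticDiscr])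
  · exact exists_integralBasis_of_index_twentySeven hq hα hK (by omega)
      (hb 1 1 0 0 (by omega) (by omega) (by omega) (by omega))
      (hc 1 2 3 4 6 2 (by omega) (by omega) (by omega) (by omega) (by omega))
      (by simp [simplestSexticBasis]) (by simp [simplestSexticDiscr])
  · have hd := isIntegral_div_two_of_even hα (by omega)
    exact exists_integralBasis_of_index_twoHundredSixteen hq hα hK
      (hd 1 0 1 1 0 0 (by omega) (by omega) (by omega))
      (hd 4 3 0 1 1 0 (by omega) (by omega) (by omega))
      (hb 4 3 0 1 (by omega) (by omega) (by omega) (by omega))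
      (hd 11 7 6 2 0 1 (by omega) (by omega) (by omega))
      (hc 1 11 7 6 2 0 (by omega) (by omega) (by omega) (by omega) (by omega))
      (by simp [simplestSexticBasis]) (by simp [simplestSexticDiscr])
  · exact exists_integralBasis_of_index_twentySeven hq hα hK (by omega)
      (hb 1 1 0 0 (by omega) (by omega) (by omega) (by omega))
      (hc 0 8 3 1 3 2 (by omega) (by omega) (by omega) (by omega) (by omega))
      (by simp [simplestSexticBasis]) (by simp [simplestSexticDiscr])
  · exact exists_integralBasis_of_index_twentySeven hq hα hK (by omega)
      (hb 1 0 0 1 (by omega) (by omega) (by omega) (by omega))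
      (hc 0 8 1 3 5 0 (by omega) (by omega) (by omega) (by omega) (by omega))
      (by simp [simplestSexticBasis]) (by simp [simplestSexticDiscr])
  · have hd := isIntegral_div_two_of_odd hα (by omega)
    exact exists_integralBasis_of_index_twoHundredSixteen hq hα hK
      (hd 1 1 0 1 0 0 (by omega) (by omega) (by omega))
      (hd 4 1 3 0 1 0 (by omega) (by omega) (by omega))
      (hb 4 1 3 0 (by omega) (by omega) (by omega) (by omega))
      (hd 5 3 7 0 2 1 (by omega) (by omega) (by omega))
      (hc 2 5 3 7 0 2 (by omega) (by omega) (by omega) (by omega) (by omega))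
      (by simp [simplestSexticBasis]) (by simp [simplestSexticDiscr])
  · exact exists_integralBasis_of_index_twentySeven hq hα hK (by omega)
      (hb 1 0 0 1 (by omega) (by omega) (by omega) (by omega))
      (hc 2 5 4 0 8 0 (by omega) (by omega) (by omega) (by omega) (by omega))
      (by simp [simplestSexticBasis]) (by simp [simplestSexticDiscr])
  · have hd := isIntegral_div_two_of_even hα (by omega)
    exact exists_integralBasis_of_index_twoHundredSixteen hq hα hK
      (hd 1 0 1 1 0 0 (by omega) (by omega) (by omega))
      (hd 1 1 3 0 1 0 (by omega) (by omega) (by omega))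
      (hb 1 1 3 0 (by omega) (by omega) (by omega) (by omega))
      (hd 11 3 4 6 2 1 (by omega) (by omega) (by omega))
      (hc 1 11 3 4 6 2 (by omega) (by omega) (by omega) (by omega) (by omega))
      (by simp [simplestSexticBasis]) (by simp [simplestSexticDiscr])
  · have hd := isIntegral_div_two_of_odd hα (by omega)
    exact exists_integralBasis_of_index_twoHundredSixteen hq hα hK
      (hd 1 1 0 1 0 0 (by omega) (by omega) (by omega))
      (hd 1 0 3 1 1 0 (by omega) (by omega) (by omega))
      (hb 1 0 3 1 (by omega) (by omega) (by omega) (by omega))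
      (hd 11 7 15 2 0 1 (by omega) (by omega) (by omega))
      (hc 1 11 7 15 2 0 (by omega) (by omega) (by omega) (by omega) (by omega))
      (by simp [simplestSexticBasis]) (by simp [simplestSexticDiscr])
  · exact exists_integralBasis_of_index_twentySeven hq hα hK (by omega)
      (hb 1 1 0 0 (by omega) (by omega) (by omega) (by omega))
      (hc 0 8 3 1 3 2 (by omega) (by omega) (by omega) (by omega) (by omega))
      (by simp [simplestSexticBasis]) (by simp [simplestSexticDiscr])
  · have hd := isIntegral_div_two_of_even hα (by omega)
    exact exists_integralBasis_of_index_twoHundredSixteen hq hα hK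
      (hd 1 0 1 1 0 0 (by omega) (by omega) (by omega))
      (hd 4 3 0 1 1 0 (by omega) (by omega) (by omega))
      (hb 4 3 0 1 (by omega) (by omega) (by omega) (by omega))
      (hd 8 1 3 5 0 1 (by omega) (by omega) (by omega))
      (hc 0 8 1 3 5 0 (by omega) (by omega) (by omega) (by omega) (by omega))
      (by simp [simplestSexticBasis]) (by simp [simplestSexticDiscr])
  · exact exists_integralBasis_of_index_twentySeven hq hα hK (by omega)
      (hb 1 1 0 0 (by omega) (by omega) (by omega) (by omega))
      (hc 2 5 3 7 0 2 (by omega) (by omega) (by omega) (by omega) (by omega))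
      (by simp [simplestSexticBasis]) (by simp [simplestSexticDiscr])
  · exact exists_integralBasis_of_index_twentySeven hq hα hK (by omega)
      (hb 1 0 0 1 (by omega) (by omega) (by omega) (by omega))
      (hc 2 5 4 0 8 0 (by omega) (by omega) (by omega) (by omega) (by omega))
      (by simp [simplestSexticBasis]) (by simp [simplestSexticDiscr])
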